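/- Let $n \ge 0$ be an integer, let $W$ be a topological space and $P \subset W$ a compactly generated subspace (for example, $W$ a compact smooth $2n$-manifold and $P = \partial W$). Let $$W \xrightarrow{\ \ell\ } B \xrightarrow{\ u\ } B'$$ be continuous maps such that $\ell$ is $n$-connected (for all base points, bijective on $\pi_k$ for $k<n$ and surjective on $\pi_n$), $u$ is an $n$-co-connected Serre fibration (for all base points, injective on $\pi_n$ and bijective on $\pi_k$ for $k>n$), and $\ell_P := \ell|_P : P \to B$ is a cofibration (that is, a map with the left lifting property with respect to all Serre fibrations that are weak homotopy equivalences). Let $$\mathrm{hAut}(u\ \mathrm{rel}\ P) = \{\phi : B \to B \text{ a weak homotopy equivalence} \mid u\circ\phi = u,\ \phi\circ \ell_P = \ell_P\}$$ be the monoid, under composition, of self-equivalences of $B$ over $B'$ and under $P$, topologised as a subspace of the space of continuous maps $B \to B$ with the compact-open topology. If the pair $(W,P)$ is $c$-connected for some integer $c \le n-1$, then $\mathrm{hAut}(u\ \mathrm{rel}\ P)$ is non-empty and is an $(n-c-2)$-type: $\pi_k(\mathrm{hAut}(u\ \mathrm{rel}\ P),\phi)$ is trivial for every base point $\phi$ and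 every $k \ge 0$ with $k > n-c-2$. In particular, if $(W,P)$ is $(n-1)$-connected, then $\mathrm{hAut}(u\ \mathrm{rel}\ P)$ is weakly contractible, i.e. non-empty and path connected with trivial homotopy groups in all positive degrees. Here $(W,P)$ is called $c$-connected if the inclusion $P \to W$ is $c$-connected (no condition if $c<0$). -/

import Mathlib

open scoped unitInterval Topology

universe u

namespace RelHAut

section HomotopyGroups

variable {X Y Z : Type*} [TopologicalSpace X] [TopologicalSpace Y] [TopologicalSpace Z]

/-- The map on sets of path components induced by a continuous map. -/
def pi0Map (f : C(X, Y)) : ZerothHomotopy X → ZerothHomotopy Y :=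
  Quotient.map f fun _ _ h => h.map f.continuous

/-- The map `π_k(X, x) → π_k(Y, f x)` induced by a continuous map `f : X → Y`. -/
def piMap (k : ℕ) (f : C(X, Y)) (x : X) :
    HomotopyGroup.Pi k X x → HomotopyGroup.Pi k Y (f x) :=
  Quotient.map
    (fun p : GenLoop (Fin k) X x =>
      (⟨f.comp p.1, fun y hy => congrArg f (p.2 y hy)⟩ : GenLoop (Fin k) Y (f x)))
    fun _ _ h => h.elim fun H => ⟨H.compContinuousMap f⟩

theorem pi0Map_comp (g : C(Y, Z)) (f : C(X, Y)) :
    pi0Map (g.comp f) = pi0Map g ∘ pi0Map f := by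
  funext a
  induction a using Quotient.ind
  rfl

theorem piMap_comp (k : ℕ) (g : C(Y, Z)) (f : C(X, Y)) (x : X) :
    piMap k (g.comp f) x = piMap k g (f x) ∘ piMap k f x := by
  funext a
  induction a using Quotient.ind
  rfl

theorem pi0Map_id : pi0Map (ContinuousMap.id X) = id := by
  funext a
  induction a using Quotient.ind
  rfl

theorem piMap_id (k : ℕ) (x : X) : piMap k (ContinuousMap.id X) x = id := by
  funext a
  induction a using Quotient.ind
  rfl

/-- Weak homotopy equivalence: bijective on `π_0`, and on `π_k` for all `k ≥ 1` and all
base points. -/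
def IsWeakEquiv (f : C(X, Y)) : Prop :=
  Function.Bijective (pi0Map f) ∧
    ∀ k : ℕ, 1 ≤ k → ∀ x : X, Function.Bijective (piMap k f x)

theorem isWeakEquiv_id : IsWeakEquiv (ContinuousMap.id X) :=
  ⟨by rw [pi0Map_id]; exact Function.bijective_id,
    fun k _ x => by rw [piMap_id]; exact Function.bijective_id⟩

theorem IsWeakEquiv.comp {g : C(Y, Z)} {f : C(X, Y)} (hg : IsWeakEquiv g)
    (hf : IsWeakEquiv f) : IsWeakEquiv (g.comp f) :=
  ⟨by rw [pi0Map_comp]; exact hg.1.comp hf.1,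
    fun k hk x => by rw [piMap_comp]; exact (hg.2 k hk (f x)).comp (hf.2 k hk x)⟩

/-- `f` is `m`-connected: for all base points it induces a bijection on `π_k` for `k < m` and a
surjection on `π_m` (no condition if `m < 0`). -/
def IsConnectedMap (m : ℤ) (f : C(X, Y)) : Prop :=
  (0 ≤ m → Function.Surjective (pi0Map f)) ∧
  (0 < m → Function.Injective (pi0Map f)) ∧
  ∀ k : ℕ, 1 ≤ k → ∀ x : X,
    ((k : ℤ) ≤ m → Function.Surjective (piMap k f x)) ∧
    ((k : ℤ) < m → Function.Injective (piMap k f x))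

/-- `f` is `m`-co-connected: for all base points it induces an injection on `π_m` and a bijection
on `π_k` for `k > m`. -/
def IsCoconnectedMap (m : ℤ) (f : C(X, Y)) : Prop :=
  (m ≤ 0 → Function.Injective (pi0Map f)) ∧
  (m < 0 → Function.Surjective (pi0Map f)) ∧
  ∀ k : ℕ, 1 ≤ k → ∀ x : X,
    (m ≤ (k : ℤ) → Function.Injective (piMap k f x)) ∧
    (m < (k : ℤ) → Function.Surjective (piMap k f x))

/-- The inclusion of a subspace as a continuous map. -/
def incl (P : Set X) : C(P, X) := ⟨Subtype.val, continuous_subtype_val⟩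

/-- The pair `(X, P)` is `m`-connected: the inclusion `P → X` is an `m`-connected map.
By the long exact sequence of the pair this says that (for `m ≥ 0`) every path component of `X`
meets `P` and `π_k(X, P, p)` is trivial for all `1 ≤ k ≤ m` and all `p` in `P`. -/
def IsConnectedPair (m : ℤ) (P : Set X) : Prop :=
  IsConnectedMap m (incl P)

variable (X) in
/-- `X` is an `m`-type: `π_k(X, x)` is trivial for all `k > m` and all base points `x`. Here
`π_0` is the set of path components, so for `m = -1` this says that `X` is empty or
weakly contractible. -/
def IsHomotopyType (m : ℤ) : Prop :=
  ∀ k : ℕ, m < (k : ℤ) → ∀ x : X, Subsingleton (HomotopyGroup.Pi k X x)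

variable (X) in
/-- `X` is weakly contractible: non-empty and path connected, with vanishing homotopy groups. -/
def IsWeaklyContractible : Prop :=
  Nonempty X ∧ ∀ (k : ℕ) (x : X), Subsingleton (HomotopyGroup.Pi k X x)

/-- Serre fibration: homotopy lifting property with respect to all cubes `I^k`. -/
def IsSerreFibration (p : C(X, Y)) : Prop :=
  ∀ (k : ℕ) (H : C((Fin k → I) × I, Y)) (f : C(Fin k → I, X)),
    (∀ a, p (f a) = H (a, 0)) →
    ∃ L : C((Fin k → I) × I, X), (∀ a, L (a, 0) = f a) ∧ p.comp L = H

end HomotopyGroups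

/-- (Quillen) cofibration: left lifting property with respect to all Serre fibrations which are
weak homotopy equivalences. These are the retracts of relative cell complexes; for example
inclusions of subcomplexes of CW complexes are cofibrations. -/
def IsCofibration {A X : Type u} [TopologicalSpace A] [TopologicalSpace X] (j : C(A, X)) : Prop :=
  ∀ (E F : Type u) [TopologicalSpace E] [TopologicalSpace F] (p : C(E, F)),
    IsSerreFibration p → IsWeakEquiv p →
    ∀ (a : C(A, E)) (b : C(X, F)), p.comp a = b.comp j →
      ∃ h : C(X, E), h.comp j = a ∧ p.comp h = b

section HAut

variable {P B B' : Type*} [TopologicalSpace P] [TopologicalSpace B] [TopologicalSpace B']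

/-- `hAut(u rel P)`: the self-maps `φ` of `B` which are weak homotopy equivalences, lie over `B'`
(with respect to `u : B → B'`) and under `P` (with respect to `j : P → B`). Its elements form a
subspace of the space `C(B, B)` with the compact-open topology. -/
def hAutRel (u : C(B, B')) (j : C(P, B)) : Set C(B, B) :=
  {φ | IsWeakEquiv φ ∧ u.comp φ = u ∧ φ.comp j = j}

/-- The monoid structure on `hAut(u rel P)` given by composition. -/
instance (u : C(B, B')) (j : C(P, B)) : Monoid (hAutRel u j) where
  mul φ ψ := ⟨φ.1.comp ψ.1, φ.2.1.comp ψ.2.1,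
    by rw [← ContinuousMap.comp_assoc, φ.2.2.1, ψ.2.2.1],
    by rw [ContinuousMap.comp_assoc, ψ.2.2.2, φ.2.2.2]⟩
  one := ⟨ContinuousMap.id B, isWeakEquiv_id, ContinuousMap.comp_id u, ContinuousMap.id_comp j⟩
  mul_assoc _ _ _ := rfl
  one_mul _ := rfl
  mul_one _ := rfl

end HAut

end RelHAut

/-!
Two loops in the space of self-equivalences of `B` over `B'` and under `P`, or more generally a map
`∂I^(k+1) → hAut(u rel P)`, amount to a lifting problem of `j : P → B` against the pullback-hom
`C(I^(k+1), B) → {lifting problems of ∂I^(k+1) ⊆ I^(k+1) against u}` of `u`. To pass between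
`I^k → C(B, B)` and `I^k × B → B` one needs `B` to be compactly generated; it is, because the
`k`-ification of `B` is a trivial fibration over `B` to which `P → B` lifts, so that it has a
section (`IsCofibration.compactlyGeneratedSpace`). A lift yields maps that are homotopic to a given
weak homotopy equivalence, hence weak homotopy equivalences (`extends_hAutRel`).

Because `u` is an `n`-co-connected Serre fibration, it lifts along `∂I^d ⊆ I^d` for `d > n`
(`IsCoconnectedMap.liftsAlong`). As the product of two cube pairs is a cube pair, the pullback-hom
is a Serre fibration that lifts along `∂I^d ⊆ I^d` for `d + k ≥ n`, so in particular for `d > c`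
once `k > n - c - 2`. The map `j` is `c`-connected. What remains is the orthogonality statement
`IsCofibration.exists_lift`: a `c`-connected cofibration `j` lifts against Serre fibrations that
lift along `∂I^d ⊆ I^d` for all `d > c`.

For this, the small object argument factors `j` as `P → Z → B`, where `Z` arises from `P` by
attaching cells of dimension greater than `c` and cells `I^d` glued along a face, and `q : Z → B`
lifts along all these pairs (`exists_factorization`). Then `P → Z` lifts against the
fibrations in question by construction. Moreover `q` is a Serre fibration and a weak homotopy
equivalence: in degrees greater than `c` this is the lifting property along cells, and in low
degrees it follows from the connectivity of `j`, since maps from compact spaces of dimension at most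
`c` into `Z` deform into `P`. That deformation is the geometric heart: such a map is approximated in
each cell by a smooth map, which misses a small ball of the cell, and is then pushed out of the cell
(`exists_push_off`, `AttachData.homotopic_inl`). Finally the cofibration `j` lifts against `q`, so
it is a retract of `P → Z` and inherits its lifting property.

Statements about homotopy groups at all base points are translated into statements about extending
maps from `∂I^d` to `I^d` (`reflectsExtension_of_injective`, `ReflectsExtension.injective`,
`IsSerreFibration.exists_lift_of_surjective`), using only that the open box in `I^k × I` is a
deformation retract (`collapsible_box`).
-/

namespace RelHAut

universe v

/-! ### Collapsible pairs and relative homotopy lifting -/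

section Collapse

variable {K L C X Y : Type*} [TopologicalSpace K] [TopologicalSpace L] [TopologicalSpace C]
  [TopologicalSpace X] [TopologicalSpace Y]

/-- `K` is homeomorphic to a standard cube `I^k`. -/
def IsCube (K : Type*) [TopologicalSpace K] : Prop :=
  ∃ k : ℕ, Nonempty (K ≃ₜ (Fin k → I))

theorem isCube_fin (k : ℕ) : IsCube (Fin k → I) := ⟨k, ⟨Homeomorph.refl _⟩⟩

theorem isCube_interval : IsCube I := ⟨1, ⟨(Homeomorph.funUnique (Fin 1) I).symm⟩⟩

theorem IsCube.prod (hK : IsCube K) (hL : IsCube L) : IsCube (K × L) := by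
  obtain ⟨k, ⟨f⟩⟩ := hK
  obtain ⟨l, ⟨g⟩⟩ := hL
  exact ⟨k + l, ⟨(f.prodCongr g).trans (Fin.appendHomeomorph k l)⟩⟩

/-- The right lifting property of `p` with respect to the inclusion of the subspace `A ⊆ K`. -/
def LiftsAlong (A : Set K) (p : C(X, Y)) : Prop :=
  ∀ (φ : C(A, X)) (H : C(K, Y)), (∀ a : A, p (φ a) = H a) →
    ∃ F : C(K, X), (∀ a : A, F a = φ a) ∧ ∀ z, p (F z) = H z

theorem LiftsAlong.of_homeomorph {A : Set K} {p : C(X, Y)} (h : LiftsAlong A p) (e : L ≃ₜ K)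
    {A' : Set L} (hA : ∀ z, z ∈ A' ↔ e z ∈ A) : LiftsAlong A' p := by
  intro φ H hc
  have hm : ∀ a : A, e.symm a ∈ A' := fun a => (hA _).2 (by simp)
  obtain ⟨F, hF, hpF⟩ := h (φ.comp ⟨fun a : A => (⟨e.symm a, hm a⟩ : A'), by fun_prop⟩)
    (H.comp ⟨e.symm, e.symm.continuous⟩) (fun a => by simpa using hc ⟨e.symm a, hm a⟩)
  refine ⟨F.comp ⟨e, e.continuous⟩, fun a => ?_, fun z => ?_⟩
  · have := hF ⟨e a, (hA _).1 a.2⟩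
    simpa using this
  · simpa using hpF (e z)

/-- The subspace `A ⊆ K` is a strong deformation retract in the following controlled sense: each
point `z` of `K` is reached at time `τ z` by a path `G (z, ·)` that starts in `A`, where `τ`
vanishes on `A`. -/
def Collapsible (A : Set K) : Prop :=
  ∃ (τ : C(K, I)) (G : C(K × I, K)),
    (∀ z ∈ A, τ z = 0) ∧ (∀ z, G (z, 0) ∈ A) ∧ ∀ z, G (z, τ z) = z

theorem Collapsible.of_homeomorph {A : Set K} (h : Collapsible A) (e : L ≃ₜ K)
    {A' : Set L} (hA : ∀ z, z ∈ A' ↔ e z ∈ A) : Collapsible A' := by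
  obtain ⟨τ, G, h1, h2, h3⟩ := h
  refine ⟨τ.comp ⟨e, e.continuous⟩, ⟨fun z => e.symm (G (e z.1, z.2)), by fun_prop⟩, ?_, ?_, ?_⟩
  · exact fun z hz => h1 _ ((hA z).1 hz)
  · exact fun z => (hA _).2 (by simpa using h2 (e z))
  · exact fun z => by simp [h3]

theorem Collapsible.prod_left {A : Set K} (h : Collapsible A) :
    Collapsible {z : C × K | z.2 ∈ A} := by
  obtain ⟨τ, G, h1, h2, h3⟩ := h
  refine ⟨τ.comp ⟨Prod.snd, by fun_prop⟩, ⟨fun z => (z.1.1, G (z.1.2, z.2)), by fun_prop⟩,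
    ?_, ?_, ?_⟩
  · exact fun z hz => h1 _ hz
  · exact fun z => h2 _
  · exact fun z => Prod.ext rfl (h3 _)

theorem collapsible_face {ι : Type*} [DecidableEq ι] (i : ι) :
    Collapsible {y : ι → I | y i = 0} := by
  refine ⟨⟨fun y => y i, by fun_prop⟩, ⟨fun z => Function.update z.1 i z.2, by fun_prop⟩,
    fun z hz => hz, fun z => ?_, fun z => ?_⟩ <;> simp

theorem Collapsible.exists_extension {A : Set K} (h : Collapsible A) (φ : C(A, X)) :
    ∃ F : C(K, X), ∀ a : A, F a = φ a := by
  obtain ⟨τ, G, h1, h2, h3⟩ := h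
  refine ⟨φ.comp ⟨fun z => ⟨G (z, 0), h2 z⟩, by fun_prop⟩, fun a => ?_⟩
  have : G (a.1, 0) = a.1 := by
    have := h3 a.1
    rwa [h1 _ a.2] at this
  simp [this]

theorem IsSerreFibration.lift_of_isCube {p : C(X, Y)} (hp : IsSerreFibration p) (hK : IsCube K)
    (H : C(K × I, Y)) (f : C(K, X)) (hf : ∀ a, p (f a) = H (a, 0)) :
    ∃ F : C(K × I, X), (∀ a, F (a, 0) = f a) ∧ ∀ z, p (F z) = H z := by
  obtain ⟨k, ⟨e⟩⟩ := hK
  obtain ⟨F, hF, hpF⟩ := hp k (H.comp ⟨fun z => (e.symm z.1, z.2), by fun_prop⟩)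
    (f.comp ⟨e.symm, e.symm.continuous⟩) (fun a => by simp [hf])
  refine ⟨F.comp ⟨fun z => (e z.1, z.2), by fun_prop⟩, fun a => by simp [hF], fun z => ?_⟩
  have := DFunLike.congr_fun hpF (e z.1, z.2)
  simpa using this

/-- A Serre fibration lifts along collapsible pairs of cubes: lift the homotopy `G` that grows
from `A`, and read off the lift of `z` at time `τ z`. -/
theorem IsSerreFibration.liftsAlong {p : C(X, Y)} (hp : IsSerreFibration p) (hK : IsCube K)
    {A : Set K} (h : Collapsible A) : LiftsAlong A p := by
  obtain ⟨τ, G, h1, h2, h3⟩ := h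
  intro φ H hc
  obtain ⟨F, hF, hpF⟩ := hp.lift_of_isCube hK (H.comp G)
    (φ.comp ⟨fun z => ⟨G (z, 0), h2 z⟩, by fun_prop⟩) (fun a => by simp [hc])
  refine ⟨F.comp ⟨fun z => (z, τ z), by fun_prop⟩, fun a => ?_, fun z => ?_⟩
  · have : G (a.1, 0) = a.1 := by
      have := h3 a.1
      rwa [h1 _ a.2] at this
    simp [h1 _ a.2, hF, this]
  · simp [hpF, h3]

end Collapse

/-! ### Boxes in cubes -/

section Box

variable {N : Type*}

theorem isClosed_boundary [Finite N] : IsClosed (Cube.boundary N) := by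
  have : Cube.boundary N = ⋃ i : N, {y | y i = 0 ∨ y i = 1} := by
    ext y; simp [Cube.boundary]
  rw [this]
  refine isClosed_iUnion_of_finite fun i => ?_
  have h0 : IsClosed {y : N → I | y i = 0} := isClosed_eq (by fun_prop) (by fun_prop)
  have h1 : IsClosed {y : N → I | y i = 1} := isClosed_eq (by fun_prop) (by fun_prop)
  exact h0.union h1

/-- Coordinates on the cube `I^N` that identify it with the unit ball of the supremum norm. -/
def centre (y : N → I) : N → ℝ := fun i => 2 * (y i : ℝ) - 1

@[fun_prop]
theorem continuous_centre : Continuous (centre : (N → I) → N → ℝ) := by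
  unfold centre; fun_prop

theorem abs_centre_le (y : N → I) (i : N) : |centre y i| ≤ 1 := by
  have h0 := (y i).2.1
  have h1 := (y i).2.2
  simp only [centre]
  rw [abs_le]; constructor <;> linarith

/-- The inverse of `centre`, extended to all of `ℝ^N` by clamping coordinates. -/
noncomputable def uncentre (x : N → ℝ) : N → I :=
  fun i => Set.projIcc 0 1 zero_le_one ((x i + 1) / 2)

@[fun_prop]
theorem continuous_uncentre : Continuous (uncentre : (N → ℝ) → N → I) := by
  unfold uncentre
  exact continuous_pi fun i => continuous_projIcc.comp (by fun_prop)

@[simp]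
theorem uncentre_centre (y : N → I) : uncentre (centre y) = y := by
  funext i
  simp only [uncentre, centre]
  rw [show (2 * (y i : ℝ) - 1 + 1) / 2 = y i by ring]
  exact Set.projIcc_val _ _

theorem uncentre_mem_boundary {x : N → ℝ} {i : N} (h : 1 ≤ |x i|) :
    uncentre x ∈ Cube.boundary N := by
  refine ⟨i, ?_⟩
  rcases le_abs.1 h with h | h
  · exact Or.inr (Set.projIcc_of_right_le _ (by linarith))
  · exact Or.inl (Set.projIcc_of_le_left _ (by linarith))

variable [Fintype N]

theorem norm_centre_le (y : N → I) : ‖centre y‖ ≤ 1 :=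
  (pi_norm_le_iff_of_nonneg zero_le_one).2 fun i => abs_centre_le y i

theorem exists_abs_eq_norm {x : N → ℝ} (hx : 0 < ‖x‖) : ∃ i, |x i| = ‖x‖ := by
  by_contra! h
  have h2 : ∀ i, ‖x i‖ < ‖x‖ := fun i => lt_of_le_of_ne (norm_le_pi_norm x i) (h i)
  exact lt_irrefl _ ((pi_norm_lt_iff hx).2 h2)

theorem norm_centre_eq_one_iff (y : N → I) : ‖centre y‖ = 1 ↔ y ∈ Cube.boundary N := by
  constructor
  · intro h
    obtain ⟨i, hi⟩ := exists_abs_eq_norm (x := centre y) (by rw [h]; norm_num)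
    refine ⟨i, ?_⟩
    rw [h] at hi
    rcases (abs_eq zero_le_one).1 hi with h | h <;> simp only [centre] at h
    · exact Or.inr (Subtype.ext (show (y i : ℝ) = 1 by linarith))
    · exact Or.inl (Subtype.ext (show (y i : ℝ) = 0 by linarith))
  · rintro ⟨i, hi⟩
    refine le_antisymm (norm_centre_le y) ?_
    have : |centre y i| = 1 := by rcases hi with h | h <;> simp [centre, h]; norm_num
    rw [← this]
    exact norm_le_pi_norm (centre y) i

variable (N) in
/-- The open box in `I^N × I`: the bottom and the walls. -/
def box : Set ((N → I) × I) := {z | z.2 = 0 ∨ z.1 ∈ Cube.boundary N}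

/-- The gauge whose level set `1` is the open box; its value is the factor by which a point must be
rescaled from the apex `(0, 2)` (in centred coordinates) in order to reach the box. -/
noncomputable def boxGauge (z : (N → I) × I) : ℝ := max ‖centre z.1‖ ((2 - (z.2 : ℝ)) / 2)

@[fun_prop]
theorem continuous_boxGauge : Continuous (boxGauge : (N → I) × I → ℝ) := by
  unfold boxGauge; fun_prop

theorem half_le_boxGauge (z : (N → I) × I) : 1 / 2 ≤ boxGauge z :=
  le_max_of_le_right (by have := z.2.2.2; linarith)

theorem boxGauge_le_one (z : (N → I) × I) : boxGauge z ≤ 1 :=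
  max_le (norm_centre_le _) (by have := z.2.2.1; linarith)

theorem boxGauge_of_mem_box {z : (N → I) × I} (h : z ∈ box N) : boxGauge z = 1 := by
  refine le_antisymm (boxGauge_le_one z) ?_
  rcases h with h | h
  · exact le_max_of_le_right (by rw [h]; norm_num)
  · exact le_max_of_le_left ((norm_centre_eq_one_iff _).2 h).ge

/-- The open box is a controlled deformation retract of the cube, by radial projection from a point
above the cube. -/
theorem collapsible_box : Collapsible (box N) := by
  -- The point `z` is rescaled from the apex by `1 / d (z, s)`: at `s = 0` it lies on the box, and
  -- it has returned to `z` at `s = 1 - boxGauge z`.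
  let d : ((N → I) × I) × I → ℝ := fun w => min (boxGauge w.1 + w.2) 1
  have hd : Continuous d := by fun_prop
  have hd0 : ∀ w, d w ≠ 0 := fun w => by
    have h1 := half_le_boxGauge w.1
    have h2 := w.2.2.1
    have : 0 < d w := lt_min (by linarith) one_pos
    exact this.ne'
  refine ⟨⟨fun z => ⟨1 - boxGauge z, by linarith [boxGauge_le_one z], by
      linarith [half_le_boxGauge z]⟩, by fun_prop⟩,
    ⟨fun w => (uncentre fun i => centre w.1.1 i / d w,
      Set.projIcc 0 1 zero_le_one (2 - (2 - (w.1.2 : ℝ)) / d w)), ?_⟩, ?_, ?_, ?_⟩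
  · refine Continuous.prodMk (continuous_uncentre.comp (continuous_pi fun i => ?_))
      (continuous_projIcc.comp ?_)
    · have : Continuous fun w : ((N → I) × I) × I => centre w.1.1 i := by
        unfold centre; fun_prop
      exact this.div hd hd0
    · exact continuous_const.sub (Continuous.div (by fun_prop) hd hd0)
  · intro z hz
    exact Subtype.ext (by simp [boxGauge_of_mem_box hz])
  · intro z
    have hdz : d (z, 0) = boxGauge z := by simp [d, boxGauge_le_one]
    have hpos : 0 < boxGauge z := by linarith [half_le_boxGauge z]
    rcases le_total ((2 - (z.2 : ℝ)) / 2) ‖centre z.1‖ with h | h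
    · have hg : boxGauge z = ‖centre z.1‖ := max_eq_left h
      obtain ⟨i, hi⟩ := exists_abs_eq_norm (x := centre z.1) (by rw [← hg]; exact hpos)
      refine Or.inr (uncentre_mem_boundary (i := i) ?_)
      simp only [hdz, hg, abs_div, abs_norm, hi]
      rw [div_self (by rw [← hg]; exact hpos.ne')]
    · have hg : boxGauge z = (2 - (z.2 : ℝ)) / 2 := max_eq_right h
      refine Or.inl (Set.projIcc_of_le_left zero_le_one ?_)
      simp only [hdz, hg]
      have : (2 - (z.2 : ℝ)) ≠ 0 := by have := z.2.2.2; linarith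
      field_simp
      norm_num
  · intro z
    have hdz : d (z, ⟨1 - boxGauge z, by linarith [boxGauge_le_one z], by
      linarith [half_le_boxGauge z]⟩) = 1 := by simp [d]
    refine Prod.ext ?_ ?_
    · simp only [ContinuousMap.coe_mk, hdz, div_one]
      exact uncentre_centre z.1
    · simp only [ContinuousMap.coe_mk, hdz, div_one]
      rw [show 2 - (2 - (z.2 : ℝ)) = z.2 by ring]
      exact Set.projIcc_val _ _

end Box

section Fill

variable {X Y : Type*} [TopologicalSpace X] [TopologicalSpace Y] {k : ℕ}

theorem append_mem_boundary_iff {m n : ℕ} (y : (Fin m → I) × (Fin n → I)) :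
    Fin.appendHomeomorph m n y ∈ Cube.boundary (Fin (m + n)) ↔
      y.1 ∈ Cube.boundary (Fin m) ∨ y.2 ∈ Cube.boundary (Fin n) := by
  constructor
  · rintro ⟨i, hi⟩
    induction i using Fin.addCases with
    | left i => exact Or.inl ⟨i, by simpa [Fin.appendHomeomorph] using hi⟩
    | right i => exact Or.inr ⟨i, by simpa [Fin.appendHomeomorph] using hi⟩
  · rintro (⟨i, hi⟩ | ⟨i, hi⟩)
    · exact ⟨Fin.castAdd n i, by simpa [Fin.appendHomeomorph] using hi⟩
    · exact ⟨Fin.natAdd m i, by simpa [Fin.appendHomeomorph] using hi⟩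

/-- The identification of `I^k × I` with `I^(k+1)`; the factor `I` is the last coordinate. -/
def snocHomeo (k : ℕ) : (Fin k → I) × I ≃ₜ (Fin (k + 1) → I) :=
  ((Homeomorph.refl _).prodCongr (Homeomorph.funUnique (Fin 1) I).symm).trans
    (Fin.appendHomeomorph k 1)

/-- The boundary of `I^k × I`. -/
def shell (k : ℕ) : Set ((Fin k → I) × I) :=
  {z | z.1 ∈ Cube.boundary (Fin k) ∨ z.2 = 0 ∨ z.2 = 1}

theorem mem_shell_iff (z : (Fin k → I) × I) :
    z ∈ shell k ↔ snocHomeo k z ∈ Cube.boundary (Fin (k + 1)) := by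
  refine Iff.trans (or_congr Iff.rfl ?_)
    (append_mem_boundary_iff (m := k) (n := 1) (z.1, fun _ => z.2)).symm
  simp [Cube.boundary]

theorem snocHomeo_last (z : (Fin k → I) × I) : snocHomeo k z (Fin.last k) = z.2 := by
  have : Fin.last k = Fin.natAdd k (0 : Fin 1) := by ext; simp
  simp [snocHomeo, this, Fin.appendHomeomorph, Fin.append_right]

theorem collapsible_shell_box :
    Collapsible {w : ((Fin k → I) × I) × I | w.2 = 0 ∨ w.1 ∈ shell k} := by
  refine (collapsible_box (N := Fin (k + 1))).of_homeomorph
    ((snocHomeo k).prodCongr (Homeomorph.refl I)) fun w => ?_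
  exact or_congr Iff.rfl (mem_shell_iff _)

/-- Filling a box in `I^k × I × I`: the squares `e`, `f₀`, `f₁` together with the walls `d`
(parametrised by `(y, t, s)`, of which only the part over `∂I^k` matters) extend over the cube;
the result is the free face `t = 1`. -/
theorem exists_fill (e f₀ f₁ : C((Fin k → I) × I, X)) (d : C((Fin k → I) × I × I, X))
    (h₀ : ∀ y, f₀ (y, 0) = e (y, 0)) (h₁ : ∀ y, f₁ (y, 0) = e (y, 1))
    (hd : ∀ y ∈ Cube.boundary (Fin k), ∀ s, d (y, 0, s) = e (y, s))
    (hd₀ : ∀ y ∈ Cube.boundary (Fin k), ∀ t, d (y, t, 0) = f₀ (y, t))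
    (hd₁ : ∀ y ∈ Cube.boundary (Fin k), ∀ t, d (y, t, 1) = f₁ (y, t)) :
    ∃ e' : C((Fin k → I) × I, X), (∀ y, e' (y, 0) = f₀ (y, 1)) ∧ (∀ y, e' (y, 1) = f₁ (y, 1)) ∧
      ∀ y ∈ Cube.boundary (Fin k), ∀ s, e' (y, s) = d (y, 1, s) := by
  classical
  let A : Set (((Fin k → I) × I) × I) := {w | w.2 = 0 ∨ w.1 ∈ shell k}
  let φ : ((Fin k → I) × I) × I → X := fun w =>
    if w.1.1 ∈ Cube.boundary (Fin k) then d (w.1.1, w.2, w.1.2) else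
    if w.2 = 0 then e w.1 else if w.1.2 = 0 then f₀ (w.1.1, w.2) else f₁ (w.1.1, w.2)
  have c1 : IsClosed {w : ((Fin k → I) × I) × I | w.1.1 ∈ Cube.boundary (Fin k)} :=
    isClosed_boundary.preimage (by fun_prop)
  have c2 : IsClosed {w : ((Fin k → I) × I) × I | w.2 = 0} :=
    isClosed_eq (by fun_prop) (by fun_prop)
  have c3 : IsClosed {w : ((Fin k → I) × I) × I | w.1.2 = 0} :=
    isClosed_eq (by fun_prop) (by fun_prop)
  have c4 : IsClosed {w : ((Fin k → I) × I) × I | w.1.2 = 1} :=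
    isClosed_eq (by fun_prop) (by fun_prop)
  have e1 : Set.EqOn φ (fun w => d (w.1.1, w.2, w.1.2))
      {w | w.1.1 ∈ Cube.boundary (Fin k)} := fun w hw => if_pos hw
  have e2 : Set.EqOn φ (fun w => e w.1) {w | w.2 = 0} := by
    rintro ⟨⟨y, s⟩, t⟩ (rfl : t = 0)
    by_cases hy : y ∈ Cube.boundary (Fin k) <;> simp [φ, hy, hd]
  have e3 : Set.EqOn φ (fun w => f₀ (w.1.1, w.2)) {w | w.1.2 = 0} := by
    rintro ⟨⟨y, s⟩, t⟩ (rfl : s = 0)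
    by_cases hy : y ∈ Cube.boundary (Fin k)
    · simp [φ, hy, hd₀]
    · by_cases ht : t = 0 <;> simp [φ, hy, ht, h₀]
  have e4 : Set.EqOn φ (fun w => f₁ (w.1.1, w.2)) {w | w.1.2 = 1} := by
    rintro ⟨⟨y, s⟩, t⟩ (rfl : s = 1)
    by_cases hy : y ∈ Cube.boundary (Fin k)
    · simp [φ, hy, hd₁]
    · by_cases ht : t = 0 <;> simp [φ, hy, ht, h₁]
  have hφ : ContinuousOn φ A := by
    have g1 := (show Continuous fun w : ((Fin k → I) × I) × I => d (w.1.1, w.2, w.1.2) by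
      fun_prop).continuousOn.congr e1
    have g2 := (show Continuous fun w : ((Fin k → I) × I) × I => e w.1 by
      fun_prop).continuousOn.congr e2
    have g3 := (show Continuous fun w : ((Fin k → I) × I) × I => f₀ (w.1.1, w.2) by
      fun_prop).continuousOn.congr e3
    have g4 := (show Continuous fun w : ((Fin k → I) × I) × I => f₁ (w.1.1, w.2) by
      fun_prop).continuousOn.congr e4
    refine ((g2.union_of_isClosed (g1.union_of_isClosed (g3.union_of_isClosed g4 c3 c4) c1
      (c3.union c4)) c2 (c1.union (c3.union c4)))).mono ?_
    exact fun w hw => hw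
  obtain ⟨F, hF⟩ := collapsible_shell_box.exists_extension
    (⟨A.domRestrict φ, hφ.domRestrict⟩ : C(A, X))
  refine ⟨F.comp ⟨fun w => (w, 1), by fun_prop⟩, fun y => ?_, fun y => ?_, fun y hy s => ?_⟩
  · exact (hF ⟨((y, 0), 1), Or.inr (Or.inr (Or.inl rfl))⟩).trans (e3 rfl)
  · exact (hF ⟨((y, 1), 1), Or.inr (Or.inr (Or.inr rfl))⟩).trans (e4 rfl)
  · exact (hF ⟨((y, s), 1), Or.inr (Or.inl hy)⟩).trans (e1 hy)

/-- Gluing of continuous maps defined on two closed subspaces. -/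
theorem exists_glue {K : Type*} [TopologicalSpace K] {S T : Set K} (hS : IsClosed S)
    (hT : IsClosed T) (f : C(S, X)) (g : C(T, X))
    (hfg : ∀ z (h₁ : z ∈ S) (h₂ : z ∈ T), f ⟨z, h₁⟩ = g ⟨z, h₂⟩) :
    ∃ F : C((S ∪ T : Set K), X), (∀ z (h : z ∈ S), F ⟨z, Or.inl h⟩ = f ⟨z, h⟩) ∧
      ∀ z (h : z ∈ T), F ⟨z, Or.inr h⟩ = g ⟨z, h⟩ := by
  classical
  let φ : (S ∪ T : Set K) → X := fun z =>
    if h : z.1 ∈ S then f ⟨z.1, h⟩ else g ⟨z.1, z.2.resolve_left h⟩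
  have e1 : ∀ z (h : z ∈ S), φ ⟨z, Or.inl h⟩ = f ⟨z, h⟩ := fun z h => dif_pos h
  have e2 : ∀ z (h : z ∈ T), φ ⟨z, Or.inr h⟩ = g ⟨z, h⟩ := fun z h => by
    by_cases h' : z ∈ S
    · exact (dif_pos h').trans (hfg z h' h)
    · exact dif_neg h'
  have hc : Continuous φ := by
    rw [← continuousOn_univ]
    have hcov : (Set.univ : Set (S ∪ T : Set K)) =
        (Subtype.val ⁻¹' S) ∪ (Subtype.val ⁻¹' T) := by
      ext z; simp only [Set.mem_univ, Set.mem_union, Set.mem_preimage, true_iff]; exact z.2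
    rw [hcov]
    refine ContinuousOn.union_of_isClosed ?_ ?_ (hS.preimage continuous_subtype_val)
      (hT.preimage continuous_subtype_val)
    · rw [continuousOn_iff_continuous_domRestrict]
      have : Continuous fun z : (Subtype.val ⁻¹' S : Set (S ∪ T : Set K)) => f ⟨z.1.1, z.2⟩ := by
        fun_prop
      exact this.congr fun z => (e1 _ z.2).symm
    · rw [continuousOn_iff_continuous_domRestrict]
      have : Continuous fun z : (Subtype.val ⁻¹' T : Set (S ∪ T : Set K)) => g ⟨z.1.1, z.2⟩ := by
        fun_prop
      exact this.congr fun z => (e2 _ z.2).symm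
  exact ⟨⟨φ, hc⟩, e1, e2⟩

/-- The map `α`, defined on a subspace `A` of `K`, extends over `K`. -/
def Extends {K : Type*} [TopologicalSpace K] {A : Set K} (α : C(A, X)) : Prop :=
  ∃ F : C(K, X), ∀ a : A, F a = α a

/-- Homotopy extension property of `(I^k, ∂I^k)`: whether a map extends from the boundary of the
cube depends on its homotopy class only. -/
theorem Extends.of_homotopic {α β : C(Cube.boundary (Fin k), X)} (h : Extends α)
    (H : α.Homotopic β) : Extends β := by
  obtain ⟨F, hF⟩ := h
  obtain ⟨H⟩ := H
  let S : Set ((Fin k → I) × I) := {z | z.2 = 0}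
  let T : Set ((Fin k → I) × I) := {z | z.1 ∈ Cube.boundary (Fin k)}
  have hS : IsClosed S := isClosed_eq (by fun_prop) (by fun_prop)
  have hT : IsClosed T := isClosed_boundary.preimage (by fun_prop)
  obtain ⟨G, hG1, hG2⟩ := exists_glue hS hT (F.comp ⟨fun z => z.1.1, by fun_prop⟩)
    (⟨fun z => H (z.1.2, ⟨z.1.1, z.2⟩), by fun_prop⟩ : C(T, X)) (by
      rintro ⟨y, t⟩ (rfl : t = 0) h2
      simpa using hF ⟨y, h2⟩)
  obtain ⟨L, hL⟩ := (collapsible_box (N := Fin k)).exists_extension G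
  refine ⟨L.comp ⟨fun y => (y, 1), by fun_prop⟩, fun a => ?_⟩
  have h1 := hL ⟨(a.1, 1), Or.inr a.2⟩
  have h2 := hG2 (a.1, 1) a.2
  exact h1.trans (h2.trans (by simp))

end Fill

/-! ### Homotopy groups and extension problems for cubes -/

section Homotopies

variable {K X Y : Type*} [TopologicalSpace K] [TopologicalSpace X] [TopologicalSpace Y]

/-- The restriction of a homotopy to a fixed time; the time parameter comes last. -/
def atTime (f : C(K × I, X)) (t : I) : C(K, X) := f.comp ⟨fun y => (y, t), by fun_prop⟩

@[simp]
theorem atTime_apply (f : C(K × I, X)) (t : I) (y : K) : atTime f t y = f (y, t) := rfl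

theorem homotopicRel_iff {f g : C(K, X)} {S : Set K} :
    f.HomotopicRel g S ↔ ∃ H : C(K × I, X), (∀ y, H (y, 0) = f y) ∧ (∀ y, H (y, 1) = g y) ∧
      ∀ y ∈ S, ∀ t, H (y, t) = f y := by
  constructor
  · rintro ⟨H⟩
    exact ⟨⟨fun z => H (z.2, z.1), by fun_prop⟩, fun y => H.apply_zero y, fun y => H.apply_one y,
      fun y hy t => H.eq_fst t hy⟩
  · rintro ⟨H, h0, h1, hS⟩
    exact ⟨⟨⟨⟨fun z => H (z.2, z.1), by fun_prop⟩, h0, h1⟩, fun t y hy => hS y hy t⟩⟩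

theorem HomotopicRel.of_eq {f g : C(K, X)} {S : Set K} (h : ∀ y, f y = g y) :
    f.HomotopicRel g S := by
  obtain rfl : f = g := ContinuousMap.ext h
  exact ContinuousMap.HomotopicRel.refl _

variable {k : ℕ}

/-- If two homotopies of maps on `I^k` agree on the boundary, and their initial stages are homotopic
relative to the boundary, then so are their final stages. -/
theorem homotopicRel_atTime_one {f g : C((Fin k → I) × I, X)}
    (hfg : ∀ y ∈ Cube.boundary (Fin k), ∀ t, f (y, t) = g (y, t))
    (h : (atTime f 0).HomotopicRel (atTime g 0) (Cube.boundary (Fin k))) :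
    (atTime f 1).HomotopicRel (atTime g 1) (Cube.boundary (Fin k)) := by
  obtain ⟨e, e0, e1, e2⟩ := homotopicRel_iff.1 h
  obtain ⟨e', h0, h1, h2⟩ := exists_fill e f g (f.comp ⟨fun z => (z.1, z.2.1), by fun_prop⟩)
    (fun y => (e0 y).symm) (fun y => (e1 y).symm) (fun y hy s => (e2 y hy s).symm)
    (fun y hy t => rfl) (fun y hy t => hfg y hy t)
  exact homotopicRel_iff.2 ⟨e', h0, h1, h2⟩

/-- The homotopy run backwards. -/
def backwards (f : C(K × I, X)) : C(K × I, X) := f.comp ⟨fun z => (z.1, σ z.2), by fun_prop⟩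

@[simp]
theorem backwards_apply (f : C(K × I, X)) (y : K) (t : I) : backwards f (y, t) = f (y, σ t) := rfl

theorem homotopicRel_atTime_zero {f g : C((Fin k → I) × I, X)}
    (hfg : ∀ y ∈ Cube.boundary (Fin k), ∀ t, f (y, t) = g (y, t))
    (h : (atTime f 1).HomotopicRel (atTime g 1) (Cube.boundary (Fin k))) :
    (atTime f 0).HomotopicRel (atTime g 0) (Cube.boundary (Fin k)) := by
  refine ((HomotopicRel.of_eq fun y => ?_).trans (homotopicRel_atTime_one (f := backwards f)
    (g := backwards g) (fun y hy t => hfg y hy _)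
    (((HomotopicRel.of_eq fun y => ?_).trans h).trans (HomotopicRel.of_eq fun y => ?_)))).trans
    (HomotopicRel.of_eq fun y => ?_) <;> simp

theorem exists_glue_box {a : C(Fin k → I, X)} {w : C((Fin k → I) × I, X)}
    (haw : ∀ y ∈ Cube.boundary (Fin k), w (y, 0) = a y) :
    ∃ φ : C(box (Fin k), X), (∀ y, φ ⟨(y, 0), Or.inl rfl⟩ = a y) ∧
      ∀ y (hy : y ∈ Cube.boundary (Fin k)) t, φ ⟨(y, t), Or.inr hy⟩ = w (y, t) := by
  obtain ⟨G, h1, h2⟩ := exists_glue (S := {z : (Fin k → I) × I | z.2 = 0})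
    (T := {z : (Fin k → I) × I | z.1 ∈ Cube.boundary (Fin k)})
    (isClosed_eq (by fun_prop) (by fun_prop)) (isClosed_boundary.preimage (by fun_prop))
    (a.comp ⟨fun z => z.1.1, by fun_prop⟩) (w.comp ⟨fun z => z.1, by fun_prop⟩) (by
      rintro ⟨y, t⟩ (rfl : t = 0) h2
      exact (haw y h2).symm)
  exact ⟨G, fun y => h1 (y, 0) rfl, fun y hy t => h2 (y, t) hy⟩

/-- Homotopy extension for `(I^k, ∂I^k)`. -/
theorem exists_homotopy_extension (a : C(Fin k → I, X)) (w : C((Fin k → I) × I, X))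
    (haw : ∀ y ∈ Cube.boundary (Fin k), w (y, 0) = a y) :
    ∃ A : C((Fin k → I) × I, X), (∀ y, A (y, 0) = a y) ∧
      ∀ y ∈ Cube.boundary (Fin k), ∀ t, A (y, t) = w (y, t) := by
  obtain ⟨φ, h1, h2⟩ := exists_glue_box haw
  obtain ⟨A, hA⟩ := collapsible_box.exists_extension φ
  exact ⟨A, fun y => (hA ⟨(y, 0), Or.inl rfl⟩).trans (h1 y),
    fun y hy t => (hA ⟨(y, t), Or.inr hy⟩).trans (h2 y hy t)⟩

/-- Relative homotopy lifting for `(I^k, ∂I^k)`. -/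
theorem IsSerreFibration.exists_homotopy_lift {p : C(X, Y)} (hp : IsSerreFibration p)
    (a : C(Fin k → I, X)) (w : C((Fin k → I) × I, X)) (H : C((Fin k → I) × I, Y))
    (haw : ∀ y ∈ Cube.boundary (Fin k), w (y, 0) = a y) (ha : ∀ y, p (a y) = H (y, 0))
    (hw : ∀ y ∈ Cube.boundary (Fin k), ∀ t, p (w (y, t)) = H (y, t)) :
    ∃ A : C((Fin k → I) × I, X), (∀ y, A (y, 0) = a y) ∧
      (∀ y ∈ Cube.boundary (Fin k), ∀ t, A (y, t) = w (y, t)) ∧ ∀ z, p (A z) = H z := by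
  obtain ⟨φ, h1, h2⟩ := exists_glue_box haw
  obtain ⟨A, hA, hpA⟩ := hp.liftsAlong ((isCube_fin k).prod isCube_interval) collapsible_box φ H
    (by
      rintro ⟨⟨y, t⟩, (rfl : t = 0) | h⟩
      · rw [h1, ha]
      · rw [h2 y h, hw y h])
  exact ⟨A, fun y => (hA ⟨(y, 0), Or.inl rfl⟩).trans (h1 y),
    fun y hy t => (hA ⟨(y, t), Or.inr hy⟩).trans (h2 y hy t), hpA⟩

/-- The linear contraction of the cube to its vertex `0`. -/
def contract (k : ℕ) : C((Fin k → I) × I, Fin k → I) :=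
  ⟨fun z i => σ z.2 * z.1 i, by fun_prop⟩

@[simp]
theorem contract_zero (y : Fin k → I) : contract k (y, 0) = y := by
  funext i; simp [contract]

@[simp]
theorem contract_one (y : Fin k → I) : contract k (y, 1) = 0 := by
  funext i; simp [contract]

end Homotopies

section Groups

variable {X Y : Type*} [TopologicalSpace X] [TopologicalSpace Y] {k : ℕ}

/-- The image of a generalised loop. -/
def genLoopMap (f : C(X, Y)) {x : X} (p : GenLoop (Fin k) X x) : GenLoop (Fin k) Y (f x) :=
  ⟨f.comp p.1, fun y hy => congrArg f (p.2 y hy)⟩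

theorem piMap_injective_iff (f : C(X, Y)) (x : X) : Function.Injective (piMap k f x) ↔
    ∀ p q : GenLoop (Fin k) X x,
      GenLoop.Homotopic (genLoopMap f p) (genLoopMap f q) → GenLoop.Homotopic p q := by
  constructor
  · intro h p q hpq
    exact Quotient.exact (h (a₁ := Quotient.mk _ p) (a₂ := Quotient.mk _ q) (Quotient.sound hpq))
  · intro h a b
    induction a using Quotient.ind
    induction b using Quotient.ind
    exact fun hab => Quotient.sound (h _ _ (Quotient.exact hab))

theorem piMap_surjective_iff (f : C(X, Y)) (x : X) : Function.Surjective (piMap k f x) ↔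
    ∀ q : GenLoop (Fin k) Y (f x), ∃ p : GenLoop (Fin k) X x,
      GenLoop.Homotopic (genLoopMap f p) q := by
  constructor
  · intro h q
    obtain ⟨a, ha⟩ := h (Quotient.mk _ q)
    induction a using Quotient.ind with
    | _ p => exact ⟨p, Quotient.exact ha⟩
  · intro h b
    induction b using Quotient.ind with
    | _ q =>
      obtain ⟨p, hp⟩ := h q
      exact ⟨Quotient.mk _ p, Quotient.sound hp⟩

theorem homotopic_genLoop_zero_iff {x : X} (p q : GenLoop (Fin 0) X x) :
    GenLoop.Homotopic p q ↔ Joined (p.1 0) (q.1 0) := by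
  constructor
  · intro h
    obtain ⟨H, h0, h1, -⟩ := homotopicRel_iff.1 h
    exact ⟨⟨⟨fun t => H (0, t), by fun_prop⟩, h0 0, h1 0⟩⟩
  · rintro ⟨γ⟩
    refine homotopicRel_iff.2 ⟨⟨fun z => γ z.2, by fun_prop⟩, fun y => ?_, fun y => ?_,
      fun y hy => hy.elim fun i => i.elim0⟩
    · obtain rfl := Subsingleton.elim y 0; exact γ.source
    · obtain rfl := Subsingleton.elim y 0; exact γ.target

theorem pi0Map_injective_iff (f : C(X, Y)) : Function.Injective (pi0Map f) ↔
    ∀ x x', Joined (f x) (f x') → Joined x x' := by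
  constructor
  · intro h x x' hxx
    exact Quotient.exact (h (a₁ := Quotient.mk _ x) (a₂ := Quotient.mk _ x') (Quotient.sound hxx))
  · intro h a b
    induction a using Quotient.ind
    induction b using Quotient.ind
    exact fun hab => Quotient.sound (h _ _ (Quotient.exact hab))

theorem pi0Map_surjective_iff (f : C(X, Y)) : Function.Surjective (pi0Map f) ↔
    ∀ y, ∃ x, Joined (f x) y := by
  constructor
  · intro h y
    obtain ⟨a, ha⟩ := h (Quotient.mk _ y)
    induction a using Quotient.ind with
    | _ x => exact ⟨x, Quotient.exact ha⟩
  · intro h b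
    induction b using Quotient.ind with
    | _ y =>
      obtain ⟨x, hx⟩ := h y
      exact ⟨Quotient.mk _ x, Quotient.sound hx⟩

theorem piMap_zero_injective_of_pi0Map {f : C(X, Y)} (h : Function.Injective (pi0Map f)) (x : X) :
    Function.Injective (piMap 0 f x) := by
  rw [piMap_injective_iff]
  intro p q hpq
  rw [homotopic_genLoop_zero_iff] at hpq ⊢
  exact (pi0Map_injective_iff f).1 h _ _ hpq

theorem pi0Map_injective_of_piMap_zero {f : C(X, Y)}
    (h : ∀ x, Function.Injective (piMap 0 f x)) : Function.Injective (pi0Map f) := by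
  rw [pi0Map_injective_iff]
  intro x x' hxx
  have key := (piMap_injective_iff f x).1 (h x)
    ⟨ContinuousMap.const _ x, fun _ _ => rfl⟩
    ⟨ContinuousMap.const _ x', fun y hy => hy.elim fun i => i.elim0⟩
  rw [homotopic_genLoop_zero_iff, homotopic_genLoop_zero_iff] at key
  exact key hxx

/-- Maps `f : X → Y` such that a map from `∂I^d` to `X` extends over the cube as soon as its image
in `Y` does: this is injectivity on `π_{d-1}` without reference to base points. -/
def ReflectsExtension (d : ℕ) (f : C(X, Y)) : Prop :=
  ∀ α : C(Cube.boundary (Fin d), X), Extends (f.comp α) → Extends α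

/-- Injectivity on `π_k` yields a statement about maps on the cube that need not be loops: contract
one of the two maps to a point and drag the other one along. -/
theorem homotopicRel_of_comp {f : C(X, Y)} (hf : ∀ x, Function.Injective (piMap k f x))
    {a b : C(Fin k → I, X)} (hab : ∀ y ∈ Cube.boundary (Fin k), a y = b y)
    (h : (f.comp a).HomotopicRel (f.comp b) (Cube.boundary (Fin k))) :
    a.HomotopicRel b (Cube.boundary (Fin k)) := by
  let w : C((Fin k → I) × I, X) := a.comp (contract k)
  obtain ⟨A, hA0, hA⟩ := exists_homotopy_extension b w (fun y hy => by simp [w, hab y hy])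
  have w0 : atTime w 0 = a := by ext y; simp [w]
  have A0 : atTime A 0 = b := by ext y; simp [hA0]
  have h1 := homotopicRel_atTime_one (f := f.comp w) (g := f.comp A)
    (fun y hy t => by simp [hA y hy]) (by
      have e1 : atTime (f.comp w) 0 = f.comp a := by rw [← w0]; rfl
      have e2 : atTime (f.comp A) 0 = f.comp b := by rw [← A0]; rfl
      rwa [e1, e2])
  have h2 := (piMap_injective_iff f (a 0)).1 (hf _)
    ⟨atTime w 1, fun y _ => by simp [w]⟩ ⟨atTime A 1, fun y hy => by simp [hA y hy, w]⟩ h1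
  have h3 := homotopicRel_atTime_zero (f := w) (g := A) (fun y hy t => (hA y hy t).symm) h2
  rwa [w0, A0] at h3

theorem box_subset_shell : box (Fin k) ⊆ shell k := fun _ h => h.symm.imp id Or.inl

theorem exists_extension_shell {f : C(X, Y)} (hf : ∀ x, Function.Injective (piMap k f x))
    (α : C(shell k, X)) (β : C((Fin k → I) × I, Y)) (hβ : ∀ z : shell k, f (α z) = β z) :
    ∃ A : C((Fin k → I) × I, X), ∀ z : shell k, A z = α z := by
  -- Extend `α` from the box; on the lid, this extension agrees with `α` up to homotopy only.
  obtain ⟨A₀, hA₀⟩ := (collapsible_box (N := Fin k)).exists_extension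
    (α.comp ⟨Set.inclusion box_subset_shell, continuous_inclusion _⟩)
  have hA₀' : ∀ z (hz : z ∈ box (Fin k)), A₀ z = α ⟨z, box_subset_shell hz⟩ :=
    fun z hz => hA₀ ⟨z, hz⟩
  let a : C(Fin k → I, X) := α.comp ⟨fun y => ⟨(y, 1), Or.inr (Or.inr rfl)⟩, by fun_prop⟩
  have key : (atTime A₀ 1).HomotopicRel a (Cube.boundary (Fin k)) := by
    refine homotopicRel_of_comp hf (fun y hy => hA₀' (y, 1) (Or.inr hy)) ?_
    have h1 := homotopicRel_atTime_one (f := f.comp A₀) (g := β) (fun y hy t => by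
      rw [← hβ ⟨(y, t), Or.inl hy⟩, ContinuousMap.comp_apply, hA₀' (y, t) (Or.inr hy)])
      (HomotopicRel.of_eq fun y => by
        rw [atTime_apply, atTime_apply, ← hβ ⟨(y, 0), Or.inr (Or.inl rfl)⟩,
          ContinuousMap.comp_apply, hA₀' (y, 0) (Or.inl rfl)])
    have e2 : atTime β 1 = f.comp a := by
      ext y; exact (hβ ⟨(y, 1), Or.inr (Or.inr rfl)⟩).symm
    rw [e2] at h1
    exact h1
  obtain ⟨H, H0, H1, H2⟩ := homotopicRel_iff.1 key
  -- Correct the lid by a further box.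
  obtain ⟨A, a0, a1, a2⟩ := exists_fill A₀ (A₀.comp ⟨fun z => (z.1, 0), by fun_prop⟩) H
    (A₀.comp ⟨fun z => (z.1, z.2.2), by fun_prop⟩) (fun y => rfl) (fun y => H0 y)
    (fun y hy s => rfl) (fun y hy t => rfl) (fun y hy t => (H2 y hy t).symm)
  refine ⟨A, ?_⟩
  rintro ⟨⟨y, t⟩, h | h | h⟩
  · exact (a2 y h t).trans (hA₀' (y, t) (Or.inr h))
  · obtain rfl : t = 0 := h
    exact (a0 y).trans (hA₀' (y, 0) (Or.inl rfl))
  · obtain rfl : t = 1 := h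
    exact (a1 y).trans (H1 y)

theorem reflectsExtension_of_injective {f : C(X, Y)}
    (hf : ∀ x, Function.Injective (piMap k f x)) : ReflectsExtension (k + 1) f := by
  rintro α ⟨β, hβ⟩
  have hm : ∀ z : shell k, snocHomeo k z ∈ Cube.boundary (Fin (k + 1)) :=
    fun z => (mem_shell_iff _).1 z.2
  obtain ⟨A, hA⟩ := exists_extension_shell hf
    (α.comp ⟨fun z : shell k => ⟨snocHomeo k z, hm z⟩, by fun_prop⟩)
    (β.comp ⟨snocHomeo k, (snocHomeo k).continuous⟩) (fun z => (hβ ⟨_, hm z⟩).symm)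
  refine ⟨A.comp ⟨(snocHomeo k).symm, (snocHomeo k).symm.continuous⟩, fun y => ?_⟩
  have := hA ⟨(snocHomeo k).symm y, (mem_shell_iff _).2 (by simp)⟩
  simpa using this

theorem ReflectsExtension.injective {f : C(X, Y)} (hf : ReflectsExtension (k + 1) f) (x : X) :
    Function.Injective (piMap k f x) := by
  rw [piMap_injective_iff]
  intro p q hpq
  obtain ⟨H, H0, H1, H2⟩ := homotopicRel_iff.1 hpq
  have c0 : IsClosed {z : (Fin k → I) × I | z.2 = 0} := isClosed_eq (by fun_prop) (by fun_prop)
  have c1 : IsClosed {z : (Fin k → I) × I | z.2 = 1} := isClosed_eq (by fun_prop) (by fun_prop)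
  obtain ⟨α₁, hα₁, hα₁'⟩ := exists_glue c0 c1 (p.1.comp ⟨fun z => z.1.1, by fun_prop⟩)
    (q.1.comp ⟨fun z => z.1.1, by fun_prop⟩) (by
      rintro ⟨y, t⟩ (h : t = 0) (h' : t = 1)
      exact absurd (h.symm.trans h') zero_ne_one)
  obtain ⟨α, hα, hα'⟩ := exists_glue (isClosed_boundary.preimage continuous_fst :
      IsClosed {z : (Fin k → I) × I | z.1 ∈ Cube.boundary (Fin k)}) (c0.union c1)
    (ContinuousMap.const _ x) α₁ (by
      rintro z hy (h | h)
      · exact ((hα₁ z h).trans (p.2 z.1 hy)).symm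
      · exact ((hα₁' z h).trans (q.2 z.1 hy)).symm)
  have hm : ∀ y : Cube.boundary (Fin (k + 1)), (snocHomeo k).symm y ∈ shell k :=
    fun y => (mem_shell_iff _).2 (by simp)
  obtain ⟨A, hA⟩ := hf (α.comp ⟨fun y => ⟨(snocHomeo k).symm y, hm y⟩, by fun_prop⟩)
    ⟨H.comp ⟨(snocHomeo k).symm, (snocHomeo k).symm.continuous⟩, by
      intro w
      change H ((snocHomeo k).symm w) = f (α ⟨(snocHomeo k).symm w, hm w⟩)
      generalize hm w = hz
      generalize (snocHomeo k).symm w = z at hz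
      obtain ⟨y, t⟩ := z
      rcases hz with h | h | h
      · rw [hα (y, t) h, H2 y h]
        exact congrArg f (p.2 y h)
      · obtain rfl : t = 0 := h
        rw [hα' (y, 0) (Or.inl rfl), hα₁ (y, 0) rfl, H0]; rfl
      · obtain rfl : t = 1 := h
        rw [hα' (y, 1) (Or.inr rfl), hα₁' (y, 1) rfl, H1]; rfl⟩
  have hA' : ∀ z (hz : z ∈ shell k), A (snocHomeo k z) = α ⟨z, hz⟩ := fun z hz => by
    have := hA ⟨snocHomeo k z, (mem_shell_iff _).1 hz⟩
    simpa using this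
  refine homotopicRel_iff.2 ⟨A.comp ⟨snocHomeo k, (snocHomeo k).continuous⟩, fun y => ?_,
    fun y => ?_, fun y hy t => ?_⟩
  · exact (hA' (y, 0) (Or.inr (Or.inl rfl))).trans
      ((hα' (y, 0) (Or.inl rfl)).trans (hα₁ (y, 0) rfl))
  · exact (hA' (y, 1) (Or.inr (Or.inr rfl))).trans
      ((hα' (y, 1) (Or.inr rfl)).trans (hα₁' (y, 1) rfl))
  · exact (hA' (y, t) (Or.inl hy)).trans ((hα (y, t) hy).trans (p.2 y hy).symm)

/-- Realising elements of the homotopy groups of the base of a Serre fibration by relative lifts: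
`w` is a homotopy whose restriction to the boundary ends at a point `x` where `π_k` is hit. -/
theorem IsSerreFibration.exists_lift_of_surjective {p : C(X, Y)} (hp : IsSerreFibration p) {x : X}
    (hx : Function.Surjective (piMap k p x)) (w : C((Fin k → I) × I, X))
    (hw : ∀ y ∈ Cube.boundary (Fin k), w (y, 1) = x) (β : C(Fin k → I, Y))
    (hβ : ∀ y ∈ Cube.boundary (Fin k), p (w (y, 0)) = β y) :
    ∃ A : C(Fin k → I, X), (∀ y ∈ Cube.boundary (Fin k), A y = w (y, 0)) ∧ ∀ y, p (A y) = β y := by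
  -- Drag `β` along `p ∘ w` to a loop, lift that loop strictly, and drag the lift back along `w`.
  obtain ⟨B, hB0, hB⟩ := exists_homotopy_extension β (p.comp w) hβ
  obtain ⟨θ, hθ⟩ := (piMap_surjective_iff p x).1 hx
    ⟨atTime B 1, fun y hy => by simp [hB y hy, hw y hy]⟩
  obtain ⟨H, H0, H1, H2⟩ := homotopicRel_iff.1 hθ
  obtain ⟨T, hT0, hT, hpT⟩ := hp.exists_homotopy_lift θ.1 (ContinuousMap.const _ x) H
    (fun y hy => (θ.2 y hy).symm) (fun y => (H0 y).symm)
    (fun y hy t => by rw [H2 y hy]; exact congrArg p (θ.2 y hy).symm)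
  obtain ⟨A, hA0, hA, hpA⟩ := hp.exists_homotopy_lift (atTime T 1) (backwards w) (backwards B)
    (fun y hy => by simp [hT y hy, hw y hy])
    (fun y => by simp only [atTime_apply, hpT, H1, backwards_apply, unitInterval.symm_zero])
    (fun y hy t => by simp [hB y hy])
  refine ⟨atTime A 1, fun y hy => by simp [hA y hy], fun y => by simp [hpA, hB0]⟩

/-- Extend the given partial lift by injectivity on `π_k`, then correct its image by surjectivity on
`π_(k+1)`. -/
theorem IsSerreFibration.liftsAlong_boundary {p : C(X, Y)} (hp : IsSerreFibration p)
    (hinj : ∀ x, Function.Injective (piMap k p x))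
    (hsurj : ∀ x, Function.Surjective (piMap (k + 1) p x)) :
    LiftsAlong (Cube.boundary (Fin (k + 1))) p := by
  intro φ β hc
  obtain ⟨A, hA⟩ := reflectsExtension_of_injective hinj φ ⟨β, fun a => (hc a).symm⟩
  obtain ⟨A', hA', hp'⟩ := hp.exists_lift_of_surjective (hsurj (A 0)) (A.comp (contract _))
    (fun y _ => by simp) β (fun y hy => by simpa [hA ⟨y, hy⟩] using hc ⟨y, hy⟩)
  exact ⟨A', fun a => by simpa [hA' a.1 a.2] using hA a, hp'⟩

/-- For a Serre fibration, surjectivity on `π_k` does not depend on the base point in a path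
component of the total space. -/
theorem IsSerreFibration.surjective_of_joined {p : C(X, Y)} (hp : IsSerreFibration p) {x x' : X}
    (h : Joined x x') (hx : Function.Surjective (piMap k p x)) :
    Function.Surjective (piMap k p x') := by
  obtain ⟨γ⟩ := h
  rw [piMap_surjective_iff]
  intro β
  obtain ⟨A, hA, hpA⟩ := hp.exists_lift_of_surjective hx
    ⟨fun z => γ (σ z.2), by fun_prop⟩ (fun y _ => by simp) β.1
    (fun y hy => by simpa using (β.2 y hy).symm)
  exact ⟨⟨A, fun y hy => by simp [hA y hy]⟩, HomotopicRel.of_eq hpA⟩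

theorem LiftsAlong.surjective {p : C(X, Y)} (hp : LiftsAlong (Cube.boundary (Fin k)) p) (x : X) :
    Function.Surjective (piMap k p x) := by
  rw [piMap_surjective_iff]
  intro β
  obtain ⟨A, hA, hpA⟩ := hp (ContinuousMap.const _ x) β.1 (fun a => (β.2 a a.2).symm)
  exact ⟨⟨A, fun y hy => hA ⟨y, hy⟩⟩, HomotopicRel.of_eq hpA⟩

theorem LiftsAlong.reflectsExtension {p : C(X, Y)} (hp : LiftsAlong (Cube.boundary (Fin k)) p) :
    ReflectsExtension k p := by
  rintro α ⟨β, hβ⟩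
  obtain ⟨A, hA, -⟩ := hp α β (fun a => (hβ a).symm)
  exact ⟨A, hA⟩

/-- A map homotopic to a weak homotopy equivalence is a weak homotopy equivalence. -/
theorem IsWeakEquiv.of_homotopic {f g : C(X, Y)} (hf : IsWeakEquiv f) (h : f.Homotopic g) :
    IsWeakEquiv g := by
  obtain ⟨H⟩ := h
  refine ⟨?_, fun k hk x => ⟨?_, ?_⟩⟩
  · have : pi0Map g = pi0Map f := by
      funext a
      induction a using Quotient.ind with
      | _ x =>
        refine Quotient.sound ⟨⟨⟨fun t => H (σ t, x), by fun_prop⟩, by simp, by simp⟩⟩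
    rw [this]; exact hf.1
  · refine ReflectsExtension.injective (fun α hα => ?_) x
    refine reflectsExtension_of_injective (fun x => (hf.2 k hk x).1) α (hα.of_homotopic ⟨?_⟩)
    exact H.symm.compContinuousMap α
  · rw [piMap_surjective_iff]
    intro β
    -- Drag `β` along the track of the base point to a loop at `f x`, which `f` hits.
    obtain ⟨B, hB0, hB⟩ := exists_homotopy_extension β.1
      (⟨fun z => H (σ z.2, x), by fun_prop⟩ : C((Fin k → I) × I, Y))
      (fun y hy => by simpa using (β.2 y hy).symm)
    obtain ⟨θ, hθ⟩ := (piMap_surjective_iff f x).1 (hf.2 k hk x).2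
      ⟨atTime B 1, fun y hy => by simp [hB y hy]⟩
    refine ⟨θ, ?_⟩
    have key := homotopicRel_atTime_one
      (f := (⟨fun z => H (z.2, θ.1 z.1), by fun_prop⟩ : C((Fin k → I) × I, Y)))
      (g := backwards B) (fun y hy t => by
        simp only [ContinuousMap.coe_mk, backwards_apply, hB y hy, unitInterval.symm_symm]
        exact congrArg (fun v => H (t, v)) (θ.2 y hy)) (by
        refine ((HomotopicRel.of_eq fun y => ?_).trans hθ).trans (HomotopicRel.of_eq fun y => ?_)
        · simp [genLoopMap]
        · simp)
    refine ((HomotopicRel.of_eq fun y => ?_).trans key).trans (HomotopicRel.of_eq fun y => ?_)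
    · simp [genLoopMap]
    · simp [hB0]

end Groups

/-! ### Pullback-hom maps -/

section Corner

variable {D K X Y : Type*} [TopologicalSpace D] [TopologicalSpace K] [TopologicalSpace X]
  [TopologicalSpace Y]

/-- The space of lifting problems for `p : X → Y` along the inclusion of `A` in `K`. -/
def LiftingProblem (A : Set K) (p : C(X, Y)) : Set (C(A, X) × C(K, Y)) :=
  {w | ∀ a : A, p (w.1 a) = w.2 a}

/-- The pullback-hom of `p : X → Y` with the inclusion of `A` in `K`: it sends a map `K → X` to the
lifting problem that it solves. -/
def pullbackHom (A : Set K) (p : C(X, Y)) : C(C(K, X), LiftingProblem A p) where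
  toFun f := ⟨(f.restrict A, p.comp f), fun _ => rfl⟩
  continuous_toFun := by
    refine Continuous.subtype_mk (Continuous.prodMk ?_ ?_) _
    · exact ContinuousMap.continuous_restrict A
    · exact ContinuousMap.continuous_postcomp p

/-- Lifting along `S ⊆ D` against the pullback-hom of `p` and `A ⊆ K` is lifting along
`S × K ∪ D × A ⊆ D × K` against `p`. -/
theorem LiftsAlong.pullbackHom [CompactSpace K] [T2Space K] {S : Set D} (hS : IsClosed S)
    {A : Set K} (hA : IsClosed A) {p : C(X, Y)}
    (h : LiftsAlong {z : D × K | z.1 ∈ S ∨ z.2 ∈ A} p) : LiftsAlong S (pullbackHom A p) := by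
  intro φ H hc
  have : CompactSpace A := isCompact_iff_compactSpace.1 hA.isCompact
  have hH1 : Continuous fun z : {z : D × K | z.2 ∈ A} => (H z.1.1).1.1 ⟨z.1.2, z.2⟩ := by
    have : Continuous fun w : C(A, X) × A => w.1 w.2 := continuous_eval
    exact this.comp (Continuous.prodMk (by fun_prop) (by fun_prop))
  have hH2 : Continuous fun z : D × K => (H z.1).1.2 z.2 := by
    have : Continuous fun w : C(K, Y) × K => w.1 w.2 := continuous_eval
    exact this.comp (Continuous.prodMk (by fun_prop) (by fun_prop))
  have hφ : Continuous fun z : {z : D × K | z.1 ∈ S} => φ ⟨z.1.1, z.2⟩ z.1.2 := by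
    have : Continuous fun w : C(K, X) × K => w.1 w.2 := continuous_eval
    exact this.comp (Continuous.prodMk (by fun_prop) (by fun_prop))
  have hval : ∀ d (hd : d ∈ S), (H d).1 = ((φ ⟨d, hd⟩).restrict A, p.comp (φ ⟨d, hd⟩)) :=
    fun d hd => (congrArg Subtype.val (hc ⟨d, hd⟩)).symm
  obtain ⟨G, hG1, hG2⟩ := exists_glue (hS.preimage continuous_fst : IsClosed {z : D × K | z.1 ∈ S})
    (hA.preimage continuous_snd : IsClosed {z : D × K | z.2 ∈ A}) ⟨_, hφ⟩ ⟨_, hH1⟩ (by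
      rintro ⟨d, κ⟩ h1 h2
      change φ ⟨d, h1⟩ κ = (H d).1.1 ⟨κ, h2⟩
      rw [hval d h1]; rfl)
  obtain ⟨F, hF, hpF⟩ := h G ⟨_, hH2⟩ (by
    rintro ⟨⟨d, κ⟩, hz | hz⟩
    · refine (congrArg p (hG1 (d, κ) hz)).trans ?_
      change p (φ ⟨d, hz⟩ κ) = (H d).1.2 κ
      rw [hval d hz]; rfl
    · exact (congrArg p (hG2 (d, κ) hz)).trans ((H d).2 ⟨κ, hz⟩))
  refine ⟨F.curry, fun a => ?_, fun d => ?_⟩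
  · ext κ
    exact (hF ⟨(a.1, κ), Or.inl a.2⟩).trans (hG1 (a.1, κ) a.2)
  · refine Subtype.ext (Prod.ext ?_ ?_)
    · ext a
      exact (hF ⟨(d, a.1), Or.inr a.2⟩).trans (hG2 (d, a.1) a.2)
    · ext κ
      exact hpF (d, κ)

theorem isSerreFibration_of_liftsAlong {p : C(X, Y)}
    (h : ∀ k, LiftsAlong {z : (Fin k → I) × I | z.2 = 0} p) : IsSerreFibration p := by
  intro k H f hf
  obtain ⟨F, hF, hpF⟩ := h k (f.comp ⟨fun z => z.1.1, by fun_prop⟩) H (by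
    rintro ⟨⟨y, t⟩, (rfl : t = 0)⟩
    exact hf y)
  exact ⟨F, fun a => hF ⟨(a, 0), rfl⟩, ContinuousMap.ext hpF⟩

theorem IsSerreFibration.pullbackHom {p : C(X, Y)} (hp : IsSerreFibration p) (n : ℕ) :
    IsSerreFibration (pullbackHom (Cube.boundary (Fin n)) p) := by
  refine isSerreFibration_of_liftsAlong fun k => LiftsAlong.pullbackHom
    (isClosed_eq (by fun_prop) (by fun_prop)) isClosed_boundary ?_
  let e : ((Fin k → I) × I) × (Fin n → I) ≃ₜ (Fin k → I) × ((Fin n → I) × I) :=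
    (Homeomorph.prodAssoc _ _ _).trans ((Homeomorph.refl _).prodCongr (Homeomorph.prodComm _ _))
  exact (hp.liftsAlong ((isCube_fin k).prod ((isCube_fin n).prod isCube_interval))
    (collapsible_box (N := Fin n)).prod_left).of_homeomorph e fun z => Iff.rfl

theorem LiftsAlong.pullbackHom_boundary {p : C(X, Y)} {d n : ℕ}
    (h : LiftsAlong (Cube.boundary (Fin (d + n))) p) :
    LiftsAlong (Cube.boundary (Fin d)) (RelHAut.pullbackHom (Cube.boundary (Fin n)) p) :=
  LiftsAlong.pullbackHom isClosed_boundary isClosed_boundary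
    (h.of_homeomorph (Fin.appendHomeomorph d n) fun z => (append_mem_boundary_iff z).symm)

end Corner

/-! ### Attaching cells -/

section Attach

/-- Data for attaching cells to `X`: a family of cubes to be glued to `X` along maps `att i` defined
on closed subspaces `A i`, which need not be the boundaries. -/
structure AttachData (X : Type u) [TopologicalSpace X] where
  /-- the set of cells -/
  ι : Type u
  /-- the cells are cubes of dimension `dim i` -/
  dim : ι → ℕ
  /-- the part of a cell along which it is attached -/
  A : ∀ i, Set (Fin (dim i) → I)
  isClosed : ∀ i, IsClosed (A i)
  /-- the attaching maps -/
  att : ∀ i, C(A i, X)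

variable {X : Type u} [TopologicalSpace X] (D : AttachData X)

namespace AttachData

/-- The `i`-th cell. -/
abbrev Cell (i : D.ι) : Type := Fin (D.dim i) → I

open Classical in
/-- The normal form of a point of `X ⊔ ∐ Cell i` in the glued space: points of `A i` are moved to
`X`. -/
noncomputable def normalForm : X ⊕ (Σ i, D.Cell i) → X ⊕ (Σ i, D.Cell i)
  | Sum.inl x => Sum.inl x
  | Sum.inr ⟨i, y⟩ => if h : y ∈ D.A i then Sum.inl (D.att i ⟨y, h⟩) else Sum.inr ⟨i, y⟩

/-- The space obtained from `X` by attaching cells; two points are identified when they have the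
same normal form. -/
def Space : Type u := Quotient (Setoid.ker D.normalForm)

instance : TopologicalSpace D.Space :=
  inferInstanceAs (TopologicalSpace (Quotient (Setoid.ker D.normalForm)))

/-- The quotient map. -/
noncomputable def proj : C(X ⊕ (Σ i, D.Cell i), D.Space) := ⟨Quotient.mk _, continuous_quotient_mk'⟩

/-- The inclusion of `X`. -/
noncomputable def inl : C(X, D.Space) := D.proj.comp ⟨Sum.inl, continuous_inl⟩

/-- The characteristic map of the `i`-th cell. -/
noncomputable def cell (i : D.ι) : C(D.Cell i, D.Space) :=
  D.proj.comp ⟨fun y => Sum.inr ⟨i, y⟩, by fun_prop⟩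

theorem isQuotientMap_proj : Topology.IsQuotientMap D.proj := isQuotientMap_quotient_mk'

theorem proj_eq_iff {a b} : D.proj a = D.proj b ↔ D.normalForm a = D.normalForm b :=
  Quotient.eq (r := Setoid.ker D.normalForm)

theorem normalForm_of_mem {i : D.ι} {y : D.Cell i} (h : y ∈ D.A i) :
    D.normalForm (Sum.inr ⟨i, y⟩) = Sum.inl (D.att i ⟨y, h⟩) := dif_pos h

theorem normalForm_of_notMem {i : D.ι} {y : D.Cell i} (h : y ∉ D.A i) :
    D.normalForm (Sum.inr ⟨i, y⟩) = Sum.inr ⟨i, y⟩ := dif_neg h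

theorem cell_of_mem {i : D.ι} {y : D.Cell i} (h : y ∈ D.A i) :
    D.cell i y = D.inl (D.att i ⟨y, h⟩) :=
  D.proj_eq_iff.2 (D.normalForm_of_mem h)

theorem inl_injective : Function.Injective D.inl := fun _ _ h =>
  Sum.inl_injective (D.proj_eq_iff.1 h)

theorem cell_eq_inl_iff {i : D.ι} {y : D.Cell i} {x : X} :
    D.cell i y = D.inl x ↔ ∃ h : y ∈ D.A i, D.att i ⟨y, h⟩ = x := by
  constructor
  · intro h
    have h' : D.normalForm (Sum.inr ⟨i, y⟩) = Sum.inl x := D.proj_eq_iff.1 h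
    by_cases hy : y ∈ D.A i
    · rw [D.normalForm_of_mem hy] at h'
      exact ⟨hy, Sum.inl_injective h'⟩
    · rw [D.normalForm_of_notMem hy] at h'
      cases h'
  · rintro ⟨h, rfl⟩
    exact D.cell_of_mem h

theorem cell_eq_cell {i i' : D.ι} {y : D.Cell i} {y' : D.Cell i'} (hy : y ∉ D.A i)
    (h : D.cell i y = D.cell i' y') :
    (⟨i, y⟩ : Σ i, D.Cell i) = ⟨i', y'⟩ := by
  have h' : D.normalForm (Sum.inr ⟨i, y⟩) = D.normalForm (Sum.inr ⟨i', y'⟩) :=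
    D.proj_eq_iff.1 h
  rw [D.normalForm_of_notMem hy] at h'
  by_cases hy' : y' ∈ D.A i'
  · rw [D.normalForm_of_mem hy'] at h'
    cases h'
  · rw [D.normalForm_of_notMem hy'] at h'
    exact Sum.inr_injective h'

theorem cases (z : D.Space) : (∃ x, D.inl x = z) ∨ ∃ i y, y ∉ D.A i ∧ D.cell i y = z := by
  induction z using Quotient.ind with
  | _ a =>
    rcases a with x | ⟨i, y⟩
    · exact Or.inl ⟨x, rfl⟩
    · by_cases hy : y ∈ D.A i
      · exact Or.inl ⟨_, (D.cell_of_mem hy).symm⟩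
      · exact Or.inr ⟨i, y, hy, rfl⟩

theorem isClosed_iff {S : Set D.Space} :
    IsClosed S ↔ IsClosed (D.inl ⁻¹' S) ∧ ∀ i, IsClosed (D.cell i ⁻¹' S) := by
  rw [← D.isQuotientMap_proj.isClosed_preimage, isClosed_sum_iff, isClosed_sigma_iff]
  rfl

/-- `X` is a closed subspace of the glued space. -/
theorem isClosedEmbedding_inl : Topology.IsClosedEmbedding D.inl := by
  refine .of_continuous_injective_isClosedMap D.inl.continuous D.inl_injective fun S hS => ?_
  rw [isClosed_iff]
  refine ⟨by rwa [Set.preimage_image_eq _ D.inl_injective], fun i => ?_⟩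
  have : D.cell i ⁻¹' (D.inl '' S) = Subtype.val '' (D.att i ⁻¹' S) := by
    ext y
    constructor
    · rintro ⟨x, hx, hxy⟩
      obtain ⟨h, rfl⟩ := D.cell_eq_inl_iff.1 hxy.symm
      exact ⟨⟨y, h⟩, hx, rfl⟩
    · rintro ⟨a, ha, rfl⟩
      exact ⟨_, ha, (D.cell_of_mem a.2).symm⟩
  rw [this]
  exact (D.isClosed i).isClosedEmbedding_subtypeVal.isClosedMap _
    (hS.preimage (D.att i).continuous)

/-- Points outside `X` are closed in the glued space. -/
theorem isClosed_singleton {z : D.Space} (hz : z ∉ Set.range D.inl) : IsClosed {z} := by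
  obtain ⟨x, hx⟩ | ⟨i, y, hy, rfl⟩ := D.cases z
  · exact absurd ⟨x, hx⟩ hz
  rw [isClosed_iff]
  constructor
  · convert isClosed_empty
    ext x
    simp only [Set.mem_preimage, Set.mem_singleton_iff, Set.mem_empty_iff_false, iff_false]
    exact fun h => hz ⟨x, h⟩
  · intro i'
    refine Set.Subsingleton.isClosed fun a ha b hb => ?_
    have e1 := D.cell_eq_cell hy (Eq.symm ha)
    have e2 := D.cell_eq_cell hy (Eq.symm hb)
    have e3 := e1.symm.trans e2
    simpa using e3

variable {D} {T : Type v} [TopologicalSpace T]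

/-- Maps out of the glued space. -/
theorem exists_desc (f : C(X, T)) (g : ∀ i, C(D.Cell i, T))
    (h : ∀ i (a : D.A i), g i a = f (D.att i a)) :
    ∃ F : C(D.Space, T), (∀ x, F (D.inl x) = f x) ∧ ∀ i y, F (D.cell i y) = g i y := by
  let φ : X ⊕ (Σ i, D.Cell i) → T := Sum.elim f fun a => g a.1 a.2
  have hφ : ∀ a, φ a = φ (D.normalForm a) := by
    rintro (x | ⟨i, y⟩)
    · rfl
    · by_cases hy : y ∈ D.A i
      · rw [D.normalForm_of_mem hy]; exact h i ⟨y, hy⟩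
      · rw [D.normalForm_of_notMem hy]
  have hc : Continuous φ := by
    refine continuous_sum_dom.2 ⟨f.continuous, continuous_sigma fun i => (g i).continuous⟩
  refine ⟨⟨Quotient.lift φ fun a b hab => ?_, hc.quotient_lift _⟩, fun x => rfl,
    fun i y => rfl⟩
  rw [hφ a, hφ b]
  exact congrArg φ hab

end AttachData

end Attach

/-! ### Sequential colimits of closed embeddings -/

section SeqColim

variable {X : ℕ → Type u} [∀ N, TopologicalSpace (X N)] (f : ∀ N, C(X N, X (N + 1)))

/-- The self-map of `∐ X N` given by the transition maps. -/
def shift (a : Σ N, X N) : Σ N, X N := ⟨a.1 + 1, f a.1 a.2⟩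

/-- Two points are identified in the colimit when they become equal after finitely many
transitions. -/
def seqSetoid : Setoid (Σ N, X N) where
  r a b := ∃ k l, (shift f)^[k] a = (shift f)^[l] b
  iseqv := by
    refine ⟨fun a => ⟨0, 0, rfl⟩, fun ⟨k, l, h⟩ => ⟨l, k, h.symm⟩, ?_⟩
    rintro a b c ⟨k, l, h⟩ ⟨k', l', h'⟩
    refine ⟨k' + k, l + l', ?_⟩
    rw [Function.iterate_add_apply, h, Function.iterate_add_apply, ← h',
      ← Function.iterate_add_apply, ← Function.iterate_add_apply, add_comm]

/-- The colimit of a sequence of spaces. -/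
def SeqColim : Type u := Quotient (seqSetoid f)

instance : TopologicalSpace (SeqColim f) :=
  inferInstanceAs (TopologicalSpace (Quotient (seqSetoid f)))

/-- The canonical maps to the colimit. -/
def toColim (N : ℕ) : C(X N, SeqColim f) :=
  ⟨fun x => Quotient.mk (seqSetoid f) ⟨N, x⟩, continuous_quotient_mk'.comp continuous_sigmaMk⟩

theorem toColim_succ (N : ℕ) (x : X N) : toColim f (N + 1) (f N x) = toColim f N x :=
  Quotient.sound (s := seqSetoid f) ⟨0, 1, rfl⟩

theorem exists_toColim (z : SeqColim f) : ∃ N x, toColim f N x = z := by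
  induction z using Quotient.ind with
  | _ a => exact ⟨a.1, a.2, rfl⟩

theorem range_toColim_mono : Monotone fun N => Set.range (toColim f N) := by
  refine monotone_nat_of_le_succ fun N => ?_
  rintro _ ⟨x, rfl⟩
  exact ⟨f N x, toColim_succ f N x⟩

theorem isClosed_seqColim_iff {S : Set (SeqColim f)} :
    IsClosed S ↔ ∀ N, IsClosed (toColim f N ⁻¹' S) := by
  have h : @Topology.IsQuotientMap _ (SeqColim f) _ _ (Quotient.mk (seqSetoid f)) :=
    isQuotientMap_quotient_mk'
  rw [← h.isClosed_preimage, isClosed_sigma_iff]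
  rfl

theorem exists_seqDesc {T : Type v} [TopologicalSpace T] (g : ∀ N, C(X N, T))
    (h : ∀ N x, g (N + 1) (f N x) = g N x) :
    ∃ F : C(SeqColim f, T), ∀ N x, F (toColim f N x) = g N x := by
  let φ : (Σ N, X N) → T := fun a => g a.1 a.2
  have h1 : ∀ a, φ (shift f a) = φ a := fun a => h a.1 a.2
  have h2 : ∀ k a, φ ((shift f)^[k] a) = φ a := by
    intro k
    induction k with
    | zero => exact fun a => rfl
    | succ k ih => intro a; rw [Function.iterate_succ_apply, ih, h1]
  have hc : Continuous φ := continuous_sigma fun N => (g N).continuous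
  refine ⟨⟨Quotient.lift φ ?_, hc.quotient_lift _⟩, fun N x => rfl⟩
  rintro a b ⟨k, l, hkl⟩
  rw [← h2 k a, hkl, h2]

variable {f}

theorem toColim_injective (hf : ∀ N, Function.Injective (f N)) (N : ℕ) :
    Function.Injective (toColim f N) := by
  intro x y hxy
  obtain ⟨k, l, h⟩ := Quotient.exact (s := seqSetoid f) hxy
  have hfst : ∀ k (a : Σ N, X N), ((shift f)^[k] a).1 = a.1 + k := by
    intro k
    induction k with
    | zero => exact fun a => rfl
    | succ k ih => intro a; rw [Function.iterate_succ_apply, ih]; simp [shift]; omega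
  have hkl : k = l := by
    have := congrArg Sigma.fst h
    rw [hfst, hfst] at this
    simpa using this
  subst hkl
  have hs : Function.Injective (shift f) := by
    rintro ⟨a, x⟩ ⟨b, y⟩ hab
    have e1 : a = b := by simpa [shift] using congrArg Sigma.fst hab
    subst e1
    have e2 : f a x = f a y := by simpa [shift] using hab
    rw [hf a e2]
  simpa using (hs.iterate k) h

theorem isClosedEmbedding_toColim (hf : ∀ N, Topology.IsClosedEmbedding (f N)) (N : ℕ) :
    Topology.IsClosedEmbedding (toColim f N) := by
  have hinj := toColim_injective fun N => (hf N).injective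
  refine .of_continuous_injective_isClosedMap (toColim f N).continuous (hinj N) fun S hS => ?_
  rw [isClosed_seqColim_iff]
  have up : ∀ M, N ≤ M → IsClosed (toColim f M ⁻¹' (toColim f N '' S)) := by
    intro M hM
    induction M, hM using Nat.le_induction with
    | base => rwa [Set.preimage_image_eq _ (hinj N)]
    | succ M hM ih =>
      have : toColim f (M + 1) ⁻¹' (toColim f N '' S) =
          f M '' (toColim f M ⁻¹' (toColim f N '' S)) := by
        ext y
        constructor
        · rintro ⟨s, hs, hsy⟩
          obtain ⟨x, hx⟩ := range_toColim_mono f hM ⟨s, rfl⟩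
          refine ⟨x, ⟨s, hs, hx.symm⟩, hinj (M + 1) ?_⟩
          exact (toColim_succ f M x).trans (hx.trans hsy)
        · rintro ⟨x, ⟨s, hs, hsx⟩, rfl⟩
          exact ⟨s, hs, hsx.trans (toColim_succ f M x).symm⟩
      rw [this]
      exact (hf M).isClosedMap _ ih
  intro M
  rcases le_total N M with h | h
  · exact up M h
  · induction h using Nat.decreasingInduction with
    | self => exact up N le_rfl
    | of_succ M hM ih =>
      have : toColim f M ⁻¹' (toColim f N '' S) =
          f M ⁻¹' (toColim f (M + 1) ⁻¹' (toColim f N '' S)) := by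
        ext x
        simp only [Set.mem_preimage, toColim_succ]
      rw [this]
      exact ih.preimage (f M).continuous

theorem isClosed_singleton_colim (hf : ∀ N, Topology.IsClosedEmbedding (f N))
    (hpt : ∀ N (z : X (N + 1)), z ∉ Set.range (f N) → IsClosed {z})
    {z : SeqColim f} (hz : z ∉ Set.range (toColim f 0)) : IsClosed {z} := by
  classical
  have hex : ∃ M, z ∈ Set.range (toColim f M) := exists_toColim f z
  have hM := Nat.find_spec hex
  rcases hM1 : Nat.find hex with _ | M
  · have hM0 := hM1
    rw [hM0] at hM
    exact absurd hM hz
  · have hlt : z ∉ Set.range (toColim f M) := Nat.find_min hex (by omega)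
    rw [hM1] at hM
    obtain ⟨x, rfl⟩ := hM
    have hx : x ∉ Set.range (f M) := by
      rintro ⟨w, rfl⟩
      exact hlt ⟨w, (toColim_succ f M w).symm⟩
    have := (isClosedEmbedding_toColim hf (M + 1)).isClosedMap _ (hpt M x hx)
    rwa [Set.image_singleton] at this

/-- A map from a compact space to the colimit of a sequence of closed embeddings lands in a finite
stage, provided that the points added at each stage are closed. -/
theorem exists_lift_stage (hf : ∀ N, Topology.IsClosedEmbedding (f N))
    (hpt : ∀ N (z : X (N + 1)), z ∉ Set.range (f N) → IsClosed {z})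
    {K : Type v} [TopologicalSpace K] [CompactSpace K] (g : C(K, SeqColim f)) :
    ∃ N, ∃ g' : C(K, X N), ∀ κ, toColim f N (g' κ) = g κ := by
  suffices h : ∃ N, Set.range g ⊆ Set.range (toColim f N) by
    obtain ⟨N, hN⟩ := h
    choose g' hg' using fun κ => hN ⟨κ, rfl⟩
    refine ⟨N, ⟨g', ?_⟩, hg'⟩
    rw [(isClosedEmbedding_toColim hf N).isInducing.continuous_iff]
    exact g.continuous.congr fun κ => (hg' κ).symm
  by_contra! hcon
  have hex : ∀ N, ∃ p ∈ Set.range g, p ∉ Set.range (toColim f N) := fun N =>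
    Set.not_subset.1 (hcon N)
  choose p hpg hp using hex
  have hmono := range_toColim_mono f
  -- Only finitely many of the points `p N` lie in a given stage, so every tail is closed.
  have hcl : ∀ n, IsClosed {z | ∃ N, n ≤ N ∧ p N = z} := by
    intro n
    rw [isClosed_seqColim_iff]
    intro M
    have : toColim f M ⁻¹' {z | ∃ N, n ≤ N ∧ p N = z} =
        ⋃ N ∈ {N | n ≤ N ∧ N < M}, toColim f M ⁻¹' {p N} := by
      ext x
      simp only [Set.mem_preimage, Set.mem_ofPred_eq, Set.mem_iUnion, Set.mem_singleton_iff,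
        exists_prop]
      constructor
      · rintro ⟨N, hN, hx⟩
        refine ⟨N, ⟨hN, ?_⟩, hx.symm⟩
        by_contra! hMN
        exact hp N (hmono hMN ⟨x, hx.symm⟩)
      · rintro ⟨N, ⟨hN, -⟩, hx⟩
        exact ⟨N, hN, hx.symm⟩
    rw [this]
    refine ((Set.finite_lt_nat M).subset fun N hN => hN.2).isClosed_biUnion fun N _ => ?_
    exact (isClosed_singleton_colim hf hpt fun h => hp N (hmono (Nat.zero_le N) h)).preimage
      (toColim f M).continuous
  obtain ⟨n, hn⟩ := (isCompact_range g.continuous).elim_directed_cover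
    (fun n => {z | ∃ N, n ≤ N ∧ p N = z}ᶜ) (fun n => (hcl n).isOpen_compl) (by
      intro z _
      obtain ⟨M, x, rfl⟩ := exists_toColim f z
      refine Set.mem_iUnion.2 ⟨M, ?_⟩
      rintro ⟨N, hN, hx⟩
      exact hp N (hmono hN ⟨x, hx.symm⟩)) (by
      refine Monotone.directed_le fun a b hab => Set.compl_subset_compl.2 ?_
      rintro z ⟨N, hN, hz⟩
      exact ⟨N, hab.trans hN, hz⟩)
  exact hn (hpg n) ⟨n, le_rfl, rfl⟩

end SeqColim

/-! ### Pushing low-dimensional maps off cells -/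

section PushOff

/-- The straight line from `a` to `b` in a cube. -/
noncomputable def line {ι : Type*} (a b : ι → I) (s : I) : ι → I :=
  fun i => Set.projIcc 0 1 zero_le_one ((1 - s : ℝ) * a i + s * b i)

@[fun_prop]
theorem continuous_line {ι : Type*} :
    Continuous fun w : (ι → I) × (ι → I) × I => line w.1 w.2.1 w.2.2 := by
  unfold line
  exact continuous_pi fun i => continuous_projIcc.comp (by fun_prop)

@[simp]
theorem line_zero {ι : Type*} (a b : ι → I) : line a b 0 = a := by
  funext i; simp [line]

@[simp]
theorem line_one {ι : Type*} (a b : ι → I) : line a b 1 = b := by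
  funext i; simp [line]

@[simp]
theorem line_self {ι : Type*} (a : ι → I) (s : I) : line a a s = a := by
  funext i
  simp only [line]
  rw [show (1 - s : ℝ) * a i + s * a i = a i by ring]
  exact Set.projIcc_val _ _

/-- A map `f` from a compact space to a space obtained by attaching cells is homotopic into the
base, if each cell can be deformed (depending on a parameter `κ`) so that `f κ` moves into the
attaching locus. -/
theorem AttachData.homotopic_inl {X : Type u} [TopologicalSpace X] (D : AttachData X)
    {K : Type v} [TopologicalSpace K] [CompactSpace K] [T2Space K] (f : C(K, D.Space))
    (T : ∀ i, C(K × D.Cell i, D.Cell i)) (hT : ∀ i κ, ∀ y ∈ D.A i, T i (κ, y) = y)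
    (hfT : ∀ i κ y, f κ = D.cell i y → T i (κ, y) ∈ D.A i) :
    ∃ g : C(K, X), f.Homotopic (D.inl.comp g) := by
  obtain ⟨Ψ, hΨ₁, hΨ₂⟩ := AttachData.exists_desc (D := D) (T := C(K × I, D.Space))
    (ContinuousMap.curry ⟨fun z => D.inl z.1, by fun_prop⟩)
    (fun i => ContinuousMap.curry
      ⟨fun z => D.cell i (line z.1 (T i (z.2.1, z.1)) z.2.2), by fun_prop⟩) (by
      intro i a
      ext z
      simp [hT i z.1 a a.2, D.cell_of_mem a.2])
  have hev : Continuous fun w : C(K × I, D.Space) × (K × I) => w.1 w.2 := continuous_eval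
  have hc : Continuous fun z : I × K => Ψ (f z.2) (z.2, z.1) :=
    hev.comp (Continuous.prodMk (by fun_prop) (by fun_prop))
  have h0 : ∀ κ, Ψ (f κ) (κ, 0) = f κ := by
    intro κ
    obtain ⟨x, hx⟩ | ⟨i, y, -, hy⟩ := D.cases (f κ)
    · rw [← hx, hΨ₁]; rfl
    · rw [← hy, hΨ₂]; simp
  have h1 : ∀ κ, ∃ x, D.inl x = Ψ (f κ) (κ, 1) := by
    intro κ
    obtain ⟨x, hx⟩ | ⟨i, y, -, hy⟩ := D.cases (f κ)
    · rw [← hx, hΨ₁]; exact ⟨x, rfl⟩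
    · have := hfT i κ y hy.symm
      rw [← hy, hΨ₂]
      exact ⟨_, by simpa using (D.cell_of_mem this).symm⟩
  choose g hg using h1
  refine ⟨⟨g, ?_⟩, ⟨⟨⟨_, hc⟩, h0, fun κ => (hg κ).symm⟩⟩⟩
  rw [D.isClosedEmbedding_inl.isInducing.continuous_iff]
  exact (hc.comp (Continuous.prodMk continuous_const continuous_id : Continuous fun κ : K =>
    ((1 : I), κ))).congr fun κ => (hg κ).symm

variable {d : ℕ}

/-- Pushing away from `y₀`, the map `x ↦ x + R (1 - ‖x‖) (x - y₀)` takes points of the unit ball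
that are not close to `y₀` out of the open unit ball. -/
theorem exists_one_le_abs_push {x y₀ : Fin d → ℝ} {ε R : ℝ} (hε : 0 < ε) (hx : ‖x‖ ≤ 1)
    (hy : ‖y₀‖ ≤ 1 / 4) (hxy : ε ≤ ‖x - y₀‖) (hR : 4 ≤ R) (hRε : 3 ≤ R * ε) :
    ∃ i, 1 ≤ |(x + (R * (1 - ‖x‖)) • (x - y₀)) i| := by
  rcases le_or_gt (1 / 2) ‖x‖ with h | h
  · obtain ⟨i, hi⟩ := exists_abs_eq_norm (x := x) (by linarith)
    refine ⟨i, ?_⟩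
    have hyi : |y₀ i| ≤ 1 / 4 := (norm_le_pi_norm y₀ i).trans hy
    rw [abs_le] at hyi
    simp only [Pi.add_apply, Pi.smul_apply, Pi.sub_apply, smul_eq_mul]
    rw [le_abs]
    have hn : 0 ≤ R * (1 - ‖x‖) := by nlinarith
    have h4 : 4 * (1 - ‖x‖) ≤ R * (1 - ‖x‖) := by nlinarith
    rcases abs_cases (x i) with ⟨h1, -⟩ | ⟨h1, -⟩
    · left
      nlinarith [mul_le_mul_of_nonneg_left (show 1 / 4 ≤ x i - y₀ i by linarith) hn]
    · right
      nlinarith [mul_le_mul_of_nonneg_left (show x i - y₀ i ≤ -(1 / 4) by linarith) hn]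
  · obtain ⟨i, hi⟩ := exists_abs_eq_norm (x := x - y₀) (by linarith)
    refine ⟨i, ?_⟩
    have hxi : |x i| ≤ ‖x‖ := norm_le_pi_norm x i
    have hn : 0 ≤ R * (1 - ‖x‖) := by nlinarith
    have h1 : |(R * (1 - ‖x‖)) * (x - y₀) i| = R * (1 - ‖x‖) * ‖x - y₀‖ := by
      rw [abs_mul, hi, abs_of_nonneg hn]
    have h2 : 3 / 2 ≤ R * (1 - ‖x‖) * ‖x - y₀‖ := by
      have : R * (1 - ‖x‖) * ε ≤ R * (1 - ‖x‖) * ‖x - y₀‖ := mul_le_mul_of_nonneg_left hxy hn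
      nlinarith
    have h3 := abs_sub_abs_le_abs_sub ((R * (1 - ‖x‖)) * (x - y₀) i) (-(x i))
    rw [abs_neg, sub_neg_eq_add, add_comm _ (x i)] at h3
    simp only [Pi.add_apply, Pi.smul_apply, smul_eq_mul]
    linarith

/-- Cut-off functions on `[0, 1]`: `ramp a` is `1` up to `(a - 1) / 4` and `0` from `a / 4` on. -/
noncomputable def ramp (a r : ℝ) : ℝ := max 0 (min 1 (a - 4 * r))

@[fun_prop]
theorem continuous_ramp (a : ℝ) : Continuous (ramp a) := by unfold ramp; fun_prop

theorem ramp_nonneg (a r : ℝ) : 0 ≤ ramp a r := le_max_left _ _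

theorem ramp_le_one (a r : ℝ) : ramp a r ≤ 1 := max_le zero_le_one (min_le_left _ _)

theorem ramp_eq_one {a r : ℝ} (h : 4 * r ≤ a - 1) : ramp a r = 1 := by
  rw [ramp, min_eq_left (by linarith), max_eq_right zero_le_one]

theorem ramp_eq_zero {a r : ℝ} (h : a ≤ 4 * r) : ramp a r = 0 :=
  max_eq_left ((min_le_right _ _).trans (by linarith))

/-- A map from the cube to `ℝ^d` which is the centred coordinate well inside the cube, and vanishes
on the boundary. -/
noncomputable def innerCoord (y : Fin d → I) : Fin d → ℝ := ramp 4 ‖centre y‖ • centre y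

@[fun_prop]
theorem continuous_innerCoord : Continuous (innerCoord : (Fin d → I) → _) := by
  unfold innerCoord; fun_prop

theorem innerCoord_of_mem_boundary {y : Fin d → I} (h : y ∈ Cube.boundary (Fin d)) :
    innerCoord y = 0 := by
  rw [innerCoord, ramp_eq_zero, zero_smul]
  rw [(norm_centre_eq_one_iff y).2 h]; norm_num

/-- A compact space of dimension less than `d` can be pushed off the interior of a `d`-dimensional
cube: approximate the given map `g` by a smooth one, whose image misses a small ball. The
hypothesis `g κ = innerCoord y` expresses that `y` is the point of the cube hit by `κ`, in terms of
a coordinate that extends by zero to the outside of the cube. -/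
theorem exists_push_off {k : ℕ} (hk : k < d) {K : Type v} [TopologicalSpace K] [CompactSpace K]
    {e : K → Fin k → ℝ} (he : Topology.IsClosedEmbedding e) (g : C(K, Fin d → ℝ)) :
    ∃ T : C(K × (Fin d → I), Fin d → I),
      (∀ κ, ∀ y ∈ Cube.boundary (Fin d), T (κ, y) = y) ∧
      ∀ κ y, g κ = innerCoord y → T (κ, y) ∈ Cube.boundary (Fin d) := by
  obtain ⟨G, hG⟩ := g.exists_extension he
  obtain ⟨p, hp, hpG, -⟩ := G.continuous.exists_contDiff_approx 1 (ε := fun _ => 1 / 8)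
    continuous_const (fun _ => by norm_num)
  have hdense := hp.dense_compl_range_of_finrank_lt_finrank (by simpa using hk)
  obtain ⟨y₀, hy₀, hy₀p⟩ := hdense.exists_mem_open Metric.isOpen_ball
    ⟨0, Metric.mem_ball_self (show (0 : ℝ) < 1 / 4 by norm_num)⟩
  have hy₀' : ‖y₀‖ ≤ 1 / 4 := by
    have := Metric.mem_ball.1 hy₀p
    rw [dist_zero_right] at this
    exact this.le
  have hpe : Continuous fun κ => p (e κ) := hp.continuous.comp he.continuous
  obtain ⟨δ, hδ, hball⟩ := Metric.isOpen_iff.1 (isCompact_range hpe).isClosed.isOpen_compl y₀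
    (fun ⟨κ, h⟩ => hy₀ ⟨e κ, h⟩)
  have hfar : ∀ κ, δ ≤ ‖p (e κ) - y₀‖ := fun κ => by
    by_contra! h
    exact hball (by rwa [Metric.mem_ball, dist_eq_norm] : p (e κ) ∈ _) ⟨κ, rfl⟩
  let ε := min δ (1 / 8)
  have hε : 0 < ε := lt_min hδ (by norm_num)
  let R := max 4 (3 / ε)
  have hRε : 3 ≤ R * ε := by
    have : 3 / ε ≤ R := le_max_right _ _
    rwa [div_le_iff₀ hε] at this
  -- In the inner part of the cube `τ` replaces `y` by the smooth approximation `p (e κ)`, which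
  -- stays away from `y₀`; the cut-off `ramp 3` vanishes where `innerCoord` is not the coordinate.
  let τ : K × (Fin d → I) → Fin d → ℝ := fun w =>
    centre w.2 + ramp 3 ‖centre w.2‖ • (p (e w.1) - centre w.2)
  have hτ : Continuous τ := by
    have : Continuous fun w : K × (Fin d → I) => p (e w.1) := hpe.comp continuous_fst
    fun_prop
  refine ⟨⟨fun w => uncentre (τ w + (R * (1 - ‖τ w‖)) • (τ w - y₀)), by fun_prop⟩, ?_, ?_⟩
  · intro κ y hy
    have h1 := (norm_centre_eq_one_iff y).2 hy
    have h2 : τ (κ, y) = centre y := by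
      simp only [τ]
      rw [ramp_eq_zero (by rw [h1]; norm_num), zero_smul, add_zero]
    simp [h2, h1]
  · intro κ y hgy
    have hclose : ramp 3 ‖centre y‖ ≠ 0 → ‖p (e κ) - centre y‖ ≤ 1 / 8 := by
      intro h
      have h3 : 4 * ‖centre y‖ < 3 := by
        by_contra! h'
        exact h (ramp_eq_zero h')
      have h4 : innerCoord y = centre y := by
        rw [innerCoord, ramp_eq_one (by linarith), one_smul]
      have h5 := hpG (e κ)
      have h6 : G (e κ) = centre y := by
        rw [← h4, ← hgy, ← hG]; rfl
      rw [h6, dist_eq_norm] at h5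
      exact h5.le
    have hdiff : ‖τ (κ, y) - centre y‖ ≤ 1 / 8 := by
      simp only [τ, add_sub_cancel_left, norm_smul, Real.norm_eq_abs,
        abs_of_nonneg (ramp_nonneg _ _)]
      by_cases h : ramp 3 ‖centre y‖ = 0
      · rw [h, zero_mul]; norm_num
      · have := hclose h
        nlinarith [ramp_le_one 3 ‖centre y‖, norm_nonneg (p (e κ) - centre y),
          ramp_nonneg 3 ‖centre y‖]
    have htri := norm_sub_norm_le (τ (κ, y)) (centre y)
    have htri' := norm_sub_norm_le (centre y) (τ (κ, y))
    rw [norm_sub_rev] at htri'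
    have hle : ‖τ (κ, y)‖ ≤ 1 := by
      by_cases h : ramp 3 ‖centre y‖ = 0
      · have : τ (κ, y) = centre y := by simp only [τ]; rw [h, zero_smul, add_zero]
        rw [this]; exact norm_centre_le y
      · have h3 : 4 * ‖centre y‖ < 3 := by
          by_contra! h'
          exact h (ramp_eq_zero h')
        linarith
    have hεle : ε ≤ ‖τ (κ, y) - y₀‖ := by
      rcases le_or_gt ‖centre y‖ (1 / 2) with h | h
      · have : τ (κ, y) = p (e κ) := by
          simp only [τ]; rw [ramp_eq_one (by linarith), one_smul, add_sub_cancel]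
        rw [this]
        exact (min_le_left _ _).trans (hfar κ)
      · have := norm_sub_norm_le (τ (κ, y)) y₀
        have h8 : ε ≤ 1 / 8 := min_le_right _ _
        linarith
    obtain ⟨i, hi⟩ := exists_one_le_abs_push hε hle hy₀' hεle (le_max_left _ _) hRε
    exact uncentre_mem_boundary hi

end PushOff

/-! ### Factorisation through a relative cell complex with cells of large dimension -/

section Factor

/-- The pairs along which cells are attached: the boundary inclusions of cubes of dimension at least
`m`, and the inclusions of faces of cubes. -/
def IsGenerating (m : ℕ) {d : ℕ} (A : Set (Fin d → I)) : Prop :=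
  (m ≤ d ∧ A = Cube.boundary (Fin d)) ∨ ∃ i, A = {y | y i = 0}

theorem IsGenerating.isClosed {m d : ℕ} {A : Set (Fin d → I)} (h : IsGenerating m A) :
    IsClosed A := by
  rcases h with ⟨-, rfl⟩ | ⟨i, rfl⟩
  · exact isClosed_boundary
  · exact isClosed_eq (by fun_prop) (by fun_prop)

/-- The right lifting property with respect to all generating pairs. -/
def LiftsGenerating (m : ℕ) {X : Type u} {Y : Type v} [TopologicalSpace X] [TopologicalSpace Y]
    (p : C(X, Y)) : Prop :=
  ∀ (d : ℕ) (A : Set (Fin d → I)), IsGenerating m A → LiftsAlong A p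

theorem IsSerreFibration.liftsGenerating {m : ℕ} {X : Type u} {Y : Type v} [TopologicalSpace X]
    [TopologicalSpace Y] {p : C(X, Y)} (hp : IsSerreFibration p)
    (h : ∀ d, m ≤ d → LiftsAlong (Cube.boundary (Fin d)) p) : LiftsGenerating m p := by
  rintro d A (⟨hd, rfl⟩ | ⟨i, rfl⟩)
  · exact h d hd
  · exact hp.liftsAlong (isCube_fin d) (collapsible_face i)

theorem LiftsGenerating.isSerreFibration {m : ℕ} {X : Type u} {Y : Type v} [TopologicalSpace X]
    [TopologicalSpace Y] {p : C(X, Y)} (hp : LiftsGenerating m p) : IsSerreFibration p :=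
  isSerreFibration_of_liftsAlong fun k =>
    (hp (k + 1) {y | y (Fin.last k) = 0} (Or.inr ⟨_, rfl⟩)).of_homeomorph (snocHomeo k)
      fun z => by
        change z.2 = 0 ↔ snocHomeo k z (Fin.last k) = 0
        rw [snocHomeo_last]

variable {X B : Type u} [TopologicalSpace X] [TopologicalSpace B] (m : ℕ)

/-- The lifting problems for `q : X → B` along generating pairs. -/
structure GeneratingProblem (q : C(X, B)) : Type u where
  /-- the dimension of the cube -/
  dim : ℕ
  /-- the subspace along which a lift is prescribed -/
  A : Set (Fin dim → I)
  isGenerating : IsGenerating m A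
  /-- the prescribed partial lift -/
  att : C(A, X)
  /-- the map to be lifted -/
  map : C(Fin dim → I, B)
  comm : ∀ a : A, q (att a) = map a

/-- One cell for each lifting problem for `q` along a generating pair. -/
abbrev cellData (q : C(X, B)) : AttachData X where
  ι := GeneratingProblem m q
  dim := GeneratingProblem.dim
  A := GeneratingProblem.A
  isClosed i := i.isGenerating.isClosed
  att := GeneratingProblem.att

theorem exists_stepMap (q : C(X, B)) : ∃ F : C((cellData m q).Space, B),
    (∀ x, F ((cellData m q).inl x) = q x) ∧
      ∀ i y, F ((cellData m q).cell i y) = GeneratingProblem.map i y :=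
  AttachData.exists_desc (D := cellData m q) q (fun i => GeneratingProblem.map i)
    fun i a => (GeneratingProblem.comm i a).symm

/-- A map from a compact space of dimension less than `m` to the space obtained by attaching
generating cells is homotopic into the base. -/
theorem exists_homotopic_inl {m : ℕ} {q : C(X, B)} {k : ℕ} (hk : k < m) {K : Type v}
    [TopologicalSpace K] [CompactSpace K] [T2Space K] {e : K → Fin k → ℝ}
    (he : Topology.IsClosedEmbedding e) (f : C(K, (cellData m q).Space)) :
    ∃ g : C(K, X), f.Homotopic ((cellData m q).inl.comp g) := by
  classical
  have key : ∀ i : GeneratingProblem m q, ∃ T : C(K × (Fin i.dim → I), Fin i.dim → I),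
      (∀ κ, ∀ y ∈ i.A, T (κ, y) = y) ∧
      ∀ κ y, f κ = (cellData m q).cell i y → T (κ, y) ∈ i.A := by
    intro i
    rcases i.isGenerating with ⟨hd, hA⟩ | ⟨j, hA⟩
    · -- `w` is the inner coordinate of the cell `i`, extended by zero to the rest of the space.
      let c : ∀ i' : GeneratingProblem m q, C(Fin i'.dim → I, Fin i.dim → ℝ) := fun i' =>
        if h : i' = i then ⟨fun y => innerCoord (fun l => y (Fin.cast (by rw [h]) l)), by fun_prop⟩
        else ContinuousMap.const _ 0
      have hself : c i = ⟨innerCoord, continuous_innerCoord⟩ := dif_pos rfl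
      obtain ⟨w, hw₁, hw₂⟩ := AttachData.exists_desc (D := cellData m q) (ContinuousMap.const _ 0) c
        (by
          intro i' a
          by_cases h : i' = i
          · subst h
            have ha : a.1 ∈ Cube.boundary _ := hA ▸ a.2
            exact (DFunLike.congr_fun hself a.1).trans (innerCoord_of_mem_boundary ha)
          · exact DFunLike.congr_fun (dif_neg h : c i' = _) a.1)
      obtain ⟨T, hT₁, hT₂⟩ := exists_push_off (hk.trans_le hd) he (w.comp f)
      refine ⟨T, by rwa [hA], fun κ y hy => ?_⟩
      rw [hA]
      refine hT₂ κ y ?_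
      rw [ContinuousMap.comp_apply, hy, hw₂, hself]
      rfl
    · refine ⟨⟨fun w => Function.update w.2 j 0, by fun_prop⟩, fun κ y hy => ?_, fun κ y _ => ?_⟩
      · rw [hA] at hy
        exact Function.update_eq_self_iff.2 (Eq.symm hy)
      · rw [hA]
        exact Function.update_self j 0 y
  choose T hT₁ hT₂ using key
  exact (cellData m q).homotopic_inl f T hT₁ hT₂

variable (B) in
/-- A space over `B`. -/
structure SpaceOver : Type (u + 1) where
  /-- the total space -/
  carrier : Type u
  [top : TopologicalSpace carrier]
  /-- the projection -/
  map : C(carrier, B)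

attribute [instance] SpaceOver.top

/-- Attach a cell for each lifting problem along a generating pair. -/
noncomputable def SpaceOver.step (S : SpaceOver B) : SpaceOver B :=
  ⟨(cellData m S.map).Space, (exists_stepMap m S.map).choose⟩

/-- The iteration of `SpaceOver.step`. -/
noncomputable def tower (S : SpaceOver B) : ℕ → SpaceOver B
  | 0 => S
  | N + 1 => (tower S N).step m

/-- The transition maps of the tower. -/
noncomputable def towerMap (S : SpaceOver B) (N : ℕ) :
    C((tower m S N).carrier, (tower m S (N + 1)).carrier) :=
  (cellData m (tower m S N).map).inl

theorem tower_map_succ (S : SpaceOver B) (N : ℕ) (x : (tower m S N).carrier) :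
    (tower m S (N + 1)).map (towerMap m S N x) = (tower m S N).map x :=
  (exists_stepMap m (tower m S N).map).choose_spec.1 x

theorem tower_map_cell (S : SpaceOver B) (N : ℕ) (i : GeneratingProblem m (tower m S N).map)
    (y : Fin i.dim → I) :
    (tower m S (N + 1)).map ((cellData m (tower m S N).map).cell i y) = i.map y :=
  (exists_stepMap m (tower m S N).map).choose_spec.2 i y

theorem isClosedEmbedding_towerMap (S : SpaceOver B) (N : ℕ) :
    Topology.IsClosedEmbedding (towerMap m S N) :=
  (cellData m (tower m S N).map).isClosedEmbedding_inl

theorem isClosed_singleton_tower (S : SpaceOver B) (N : ℕ) (z : (tower m S (N + 1)).carrier)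
    (hz : z ∉ Set.range (towerMap m S N)) : IsClosed {z} :=
  (cellData m (tower m S N).map).isClosed_singleton hz

/-- The small object argument: a map `j` factors as a relative cell complex `i` built from
generating cells, followed by a map with the right lifting property with respect to generating
pairs. Since the boundary cells of `i` have dimension at least `m`, compact spaces of smaller
dimension deform from the cell complex into `P`. -/
theorem exists_factorization {P : Type u} [TopologicalSpace P] (j : C(P, B)) :
    ∃ (Z : Type u) (_ : TopologicalSpace Z) (i : C(P, Z)) (q : C(Z, B)),
      q.comp i = j ∧ LiftsGenerating m q ∧
      (∀ (E Q : Type u) [TopologicalSpace E] [TopologicalSpace Q] (v : C(E, Q)),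
        LiftsGenerating m v → ∀ (a : C(P, E)) (b : C(Z, Q)), v.comp a = b.comp i →
          ∃ L : C(Z, E), L.comp i = a ∧ v.comp L = b) ∧
      ∀ (k : ℕ), k < m → ∀ (K : Type) [TopologicalSpace K] [CompactSpace K] [T2Space K]
        (e : K → Fin k → ℝ), Topology.IsClosedEmbedding e → ∀ f : C(K, Z),
          ∃ g : C(K, P), f.Homotopic (i.comp g) := by
  let S : SpaceOver B := ⟨P, j⟩
  have hemb := isClosedEmbedding_towerMap m S
  have hpt := isClosed_singleton_tower m S
  obtain ⟨q, hq⟩ := exists_seqDesc (towerMap m S) (fun N => (tower m S N).map)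
    (tower_map_succ m S)
  refine ⟨SeqColim (towerMap m S), inferInstance, toColim (towerMap m S) 0, q,
    ContinuousMap.ext fun x => hq 0 x, ?_, ?_, ?_⟩
  · -- A lifting problem for `q` factors through a finite stage, and is solved in the next one.
    intro d A hA φ H hc
    have : CompactSpace A := isCompact_iff_compactSpace.1 hA.isClosed.isCompact
    obtain ⟨N, φ', hφ'⟩ := exists_lift_stage hemb hpt φ
    let c : GeneratingProblem m (tower m S N).map := ⟨d, A, hA, φ', H, fun a => by
      rw [← hq, hφ', hc]⟩
    refine ⟨(toColim (towerMap m S) (N + 1)).comp ((cellData m (tower m S N).map).cell c),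
      fun a => ?_, fun z => ?_⟩
    · have h1 : (cellData m (tower m S N).map).cell c a.1 = towerMap m S N (φ' a) :=
        (cellData m (tower m S N).map).cell_of_mem (i := c) a.2
      exact (congrArg (toColim (towerMap m S) (N + 1)) h1).trans
        ((toColim_succ (towerMap m S) N (φ' a)).trans (hφ' a))
    · exact (hq (N + 1) _).trans (tower_map_cell m S N c z)
  · intro E Q _ _ v hv a b hab
    let R : ℕ → Type u := fun N =>
      {L : C((tower m S N).carrier, E) // ∀ x, v (L x) = b (toColim (towerMap m S) N x)}
    have step : ∀ N (L : R N), ∃ L' : R (N + 1), ∀ x, L'.1 (towerMap m S N x) = L.1 x := by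
      rintro N ⟨L, hL⟩
      have hcell : ∀ c : GeneratingProblem m (tower m S N).map, ∃ F : C(Fin c.dim → I, E),
          (∀ y : c.A, F y = L (c.att y)) ∧ ∀ y, v (F y) =
            b (toColim (towerMap m S) (N + 1) ((cellData m (tower m S N).map).cell c y)) := by
        intro c
        refine hv c.dim c.A c.isGenerating (L.comp c.att) ((b.comp
          (toColim (towerMap m S) (N + 1))).comp ((cellData m (tower m S N).map).cell c)) ?_
        intro y
        have h1 : (cellData m (tower m S N).map).cell c y.1 = towerMap m S N (c.att y) :=
          (cellData m (tower m S N).map).cell_of_mem (i := c) y.2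
        rw [ContinuousMap.comp_apply, hL, ← toColim_succ]
        exact congrArg (fun w => b (toColim (towerMap m S) (N + 1) w)) h1.symm
      choose F hF hvF using hcell
      obtain ⟨L', h₁, h₂⟩ := AttachData.exists_desc (D := cellData m (tower m S N).map) L F hF
      refine ⟨⟨L', fun z => ?_⟩, h₁⟩
      obtain ⟨x, rfl⟩ | ⟨c, y, -, rfl⟩ := (cellData m (tower m S N).map).cases z
      · exact (congrArg v (h₁ x)).trans
          ((hL x).trans (congrArg b (toColim_succ (towerMap m S) N x)).symm)
      · exact (congrArg v (h₂ c y)).trans (hvF c y)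
    choose next hnext using step
    let s : ∀ N, R N := fun N =>
      Nat.rec ⟨a, fun x => DFunLike.congr_fun hab x⟩ (fun N L => next N L) N
    obtain ⟨F, hF⟩ := exists_seqDesc (towerMap m S) (fun N => (s N).1) (fun N x => hnext N (s N) x)
    refine ⟨F, ContinuousMap.ext fun x => hF 0 x, ContinuousMap.ext fun z => ?_⟩
    obtain ⟨N, x, rfl⟩ := exists_toColim _ z
    rw [ContinuousMap.comp_apply, hF]
    exact (s N).2 x
  · intro k hk K _ _ _ e he f
    have down : ∀ N (g : C(K, (tower m S N).carrier)), ∃ g' : C(K, P),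
        ((toColim (towerMap m S) N).comp g).Homotopic ((toColim (towerMap m S) 0).comp g') := by
      intro N
      induction N with
      | zero => exact fun g => ⟨g, .refl _⟩
      | succ N ih =>
        intro g
        obtain ⟨g₁, h₁⟩ := exists_homotopic_inl hk he g
        obtain ⟨g₂, h₂⟩ := ih g₁
        refine ⟨g₂, (ContinuousMap.Homotopic.comp (.refl (toColim (towerMap m S) (N + 1)))
          h₁).trans ?_⟩
        have : (toColim (towerMap m S) (N + 1)).comp ((towerMap m S N).comp g₁) =
            (toColim (towerMap m S) N).comp g₁ :=
          ContinuousMap.ext fun κ => toColim_succ (towerMap m S) N (g₁ κ)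
        rw [← this] at h₂
        exact h₂
    obtain ⟨N, g, hg⟩ := exists_lift_stage hemb hpt f
    obtain ⟨g', hg'⟩ := down N g
    have : (toColim (towerMap m S) N).comp g = f := ContinuousMap.ext hg
    exact ⟨g', this ▸ hg'⟩

end Factor

/-! ### Connected cofibrations lift against co-connected fibrations -/

section Core

theorem isWeakEquiv_of_reflectsExtension {X : Type u} {Y : Type v} [TopologicalSpace X]
    [TopologicalSpace Y] {p : C(X, Y)} (h : ∀ k, ReflectsExtension (k + 1) p)
    (h₀ : Function.Surjective (pi0Map p))
    (h₁ : ∀ k, 1 ≤ k → ∀ x, Function.Surjective (piMap k p x)) : IsWeakEquiv p :=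
  ⟨⟨pi0Map_injective_of_piMap_zero (h 0).injective, h₀⟩,
    fun k hk x => ⟨(h k).injective x, h₁ k hk x⟩⟩

theorem LiftsAlong.surjective_of_zero {X : Type u} {Y : Type v} [TopologicalSpace X]
    [TopologicalSpace Y] {p : C(X, Y)} (h : LiftsAlong (Cube.boundary (Fin 0)) p) :
    Function.Surjective p := by
  intro y
  have : IsEmpty (Cube.boundary (Fin 0)) := ⟨fun a => a.2.elim fun i => i.elim0⟩
  obtain ⟨F, -, hF⟩ := h ⟨fun a => isEmptyElim a, continuous_of_discreteTopology⟩
    (ContinuousMap.const _ y) (fun a => isEmptyElim a)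
  exact ⟨F 0, hF 0⟩

theorem pi0Map_surjective_of_surjective {X : Type u} {Y : Type v} [TopologicalSpace X]
    [TopologicalSpace Y] {p : C(X, Y)} (h : Function.Surjective p) :
    Function.Surjective (pi0Map p) :=
  (pi0Map_surjective_iff p).2 fun y =>
    let ⟨x, hx⟩ := h y
    ⟨x, hx ▸ Joined.refl _⟩

theorem Extends.comp {X : Type u} {Y : Type v} [TopologicalSpace X] [TopologicalSpace Y]
    {K : Type*} [TopologicalSpace K] {A : Set K} {α : C(A, X)} (h : Extends α) (f : C(X, Y)) :
    Extends (f.comp α) := by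
  obtain ⟨F, hF⟩ := h
  exact ⟨f.comp F, fun a => congrArg f (hF a)⟩

/-- An `(m-1)`-connected cofibration has the left lifting property with respect to every Serre
fibration which lifts along `∂I^d ⊆ I^d` for all `d ≥ m`.

The cofibration is factored through a relative cell complex `Z` with cells of dimension at least
`m`; the connectivity of `j` makes `q : Z → B` a trivial fibration in low degrees too, so that the
cofibration is a retract of the relative cell complex. -/
theorem IsCofibration.exists_lift {P B E Q : Type u} [TopologicalSpace P] [TopologicalSpace B]
    [TopologicalSpace E] [TopologicalSpace Q] {j : C(P, B)} (hj : IsCofibration j) {m : ℕ}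
    (hs₀ : 1 ≤ m → Function.Surjective (pi0Map j))
    (hs : ∀ k, 1 ≤ k → k < m → ∀ x, Function.Surjective (piMap k j x))
    (hi : ∀ k, k + 1 < m → ∀ x, Function.Injective (piMap k j x))
    {v : C(E, Q)} (hv : LiftsGenerating m v) (a : C(P, E)) (b : C(B, Q))
    (hab : v.comp a = b.comp j) : ∃ h : C(B, E), h.comp j = a ∧ v.comp h = b := by
  obtain ⟨Z, _, i, q, rfl, hq, hlift, hdef⟩ := exists_factorization m j
  have hqd : ∀ d, m ≤ d → LiftsAlong (Cube.boundary (Fin d)) q :=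
    fun d hd => hq d _ (Or.inl ⟨hd, rfl⟩)
  have hqs : IsSerreFibration q := hq.isSerreFibration
  have hqr : ∀ k, ReflectsExtension (k + 1) q := by
    intro k
    rcases le_or_gt m (k + 1) with h | h
    · exact (hqd _ h).reflectsExtension
    · -- In low degrees, the given map is deformed into `P`, where `j` can be used.
      intro α hα
      have : CompactSpace (Cube.boundary (Fin (k + 1))) :=
        isCompact_iff_compactSpace.1 isClosed_boundary.isCompact
      have he : Topology.IsClosedEmbedding
          fun (y : Cube.boundary (Fin (k + 1))) (i : Fin (k + 1)) => (y.1 i : ℝ) :=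
        Continuous.isClosedEmbedding (continuous_pi fun i =>
            continuous_subtype_val.comp ((continuous_apply i).comp continuous_subtype_val))
          fun y y' hyy => Subtype.ext (funext fun i => Subtype.ext (congrFun hyy i))
      obtain ⟨α', hα'⟩ := hdef (k + 1) h _ _ he α
      have h1 : Extends ((q.comp i).comp α') :=
        hα.of_homotopic (ContinuousMap.Homotopic.comp (.refl q) hα')
      exact ((reflectsExtension_of_injective (hi k h) α' h1).comp i).of_homotopic hα'.symm
  have hqw : IsWeakEquiv q := by
    refine isWeakEquiv_of_reflectsExtension hqr ?_ fun k hk z => ?_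
    · rcases Nat.eq_zero_or_pos m with rfl | hm
      · exact pi0Map_surjective_of_surjective (hqd 0 le_rfl).surjective_of_zero
      · have := hs₀ hm
        rw [pi0Map_comp] at this
        exact this.of_comp
    · rcases le_or_gt m k with h | h
      · exact (hqd k h).surjective z
      · obtain ⟨g, ⟨H⟩⟩ := hdef 0 (by omega) Unit (fun _ => 0)
          (Continuous.isClosedEmbedding continuous_const fun _ _ _ => rfl)
          (ContinuousMap.const _ z)
        have hz : Joined z (i (g ())) :=
          ⟨⟨⟨fun t => H (t, ()), by fun_prop⟩, H.apply_zero (), H.apply_one ()⟩⟩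
        refine hqs.surjective_of_joined hz.symm ?_
        have := hs k hk h (g ())
        rw [piMap_comp] at this
        exact this.of_comp
  obtain ⟨h, hh, hqh⟩ := hj Z B q hqs hqw i (ContinuousMap.id B) rfl
  obtain ⟨L, hL, hvL⟩ := hlift E Q v hv a (b.comp q) hab
  refine ⟨L.comp h, ?_, ?_⟩
  · rw [ContinuousMap.comp_assoc, hh, hL]
  · rw [← ContinuousMap.comp_assoc, hvL, ContinuousMap.comp_assoc, hqh, ContinuousMap.comp_id]

end Core

/-! ### Compactly generated spaces -/

section CompactlyGenerated

/-- The space `B` with the compactly generated topology. -/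
def Kification (B : Type u) : Type u := B

instance (B : Type u) [TopologicalSpace B] : TopologicalSpace (Kification B) :=
  TopologicalSpace.compactlyGenerated.{u} B

/-- The identity map from the `k`-ification of `B` to `B`. -/
def fromKification (B : Type u) [TopologicalSpace B] : C(Kification B, B) :=
  ⟨fun b => b, continuous_from_compactlyGenerated (X := B) (fun b => b) fun _ g => g.continuous⟩

/-- The identity map from `B` to its `k`-ification, which need not be continuous. -/
def toKification (B : Type u) : B → Kification B := fun b => b

theorem continuous_toKification_comp {B : Type u} [TopologicalSpace B] {S : CompHaus.{u}}
    (g : C(S, B)) :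
    Continuous (toKification B ∘ g) := by
  let f : (Σ (i : (S : CompHaus.{u}) × C(S, B)), i.fst) → Kification B := fun a => a.1.2 a.2
  have hf : Continuous f := continuous_coinduced_rng
  exact hf.comp (@continuous_sigmaMk _ (fun i : (S : CompHaus.{u}) × C(S, B) => i.fst) _ ⟨S, g⟩)

theorem exists_lift_kification {B : Type u} [TopologicalSpace B] {K : Type} [TopologicalSpace K]
    [CompactSpace K] [T2Space K] (g : C(K, B)) :
    ∃ g' : C(K, Kification B), ∀ κ, fromKification B (g' κ) = g κ := by
  have h := continuous_toKification_comp (S := CompHaus.of (ULift.{u} K))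
    (g.comp ⟨ULift.down, continuous_uliftDown⟩)
  exact ⟨⟨toKification B ∘ g, h.comp continuous_uliftUp⟩, fun κ => rfl⟩

theorem liftsAlong_fromKification (B : Type u) [TopologicalSpace B] {K : Type} [TopologicalSpace K]
    [CompactSpace K] [T2Space K] (A : Set K) : LiftsAlong A (fromKification B) := by
  intro φ H hc
  obtain ⟨F, hF⟩ := exists_lift_kification H
  exact ⟨F, fun a => (hF a).trans (hc a).symm, hF⟩

/-- The target of a cofibration from a compactly generated space is compactly generated, since its
`k`-ification is a trivial fibration over it. -/
theorem IsCofibration.compactlyGeneratedSpace {P B : Type u} [TopologicalSpace P]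
    [TopologicalSpace B] [CompactlyGeneratedSpace P] {j : C(P, B)} (hj : IsCofibration j) :
    CompactlyGeneratedSpace B := by
  have hl : ∀ d, LiftsAlong (Cube.boundary (Fin d)) (fromKification B) :=
    fun d => liftsAlong_fromKification B _
  have hc : Continuous (toKification B ∘ j) :=
    continuous_from_uCompactlyGeneratedSpace _ fun S g => continuous_toKification_comp (j.comp g)
  obtain ⟨h, -, hh⟩ := hj (Kification B) B (fromKification B)
    (isSerreFibration_of_liftsAlong fun k => liftsAlong_fromKification B _)
    (isWeakEquiv_of_reflectsExtension (fun k => (hl (k + 1)).reflectsExtension)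
      (pi0Map_surjective_of_surjective (hl 0).surjective_of_zero) fun k _ => (hl k).surjective)
    ⟨toKification B ∘ j, hc⟩ (ContinuousMap.id B) rfl
  have hid : (h : B → Kification B) = fun b => b := funext fun b => DFunLike.congr_fun hh b
  have hcont := h.continuous
  rw [hid] at hcont
  exact ⟨continuous_id_iff_le.1 hcont⟩

theorem continuous_flip {S : Type u} {K : Type} {Y : Type v} [TopologicalSpace S]
    [TopologicalSpace K] [TopologicalSpace Y] [CompactSpace S] [T2Space S] (F : C(K, C(S, Y))) :
    Continuous fun z : S × K => F z.2 z.1 := by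
  have hev : Continuous fun w : C(S, Y) × S => w.1 w.2 := continuous_eval
  exact hev.comp ((F.continuous.comp continuous_snd).prodMk continuous_fst)

/-- A compact family of maps out of a compactly generated space is jointly continuous. -/
theorem exists_flip {B : Type u} {K : Type} {Y : Type v} [TopologicalSpace B] [TopologicalSpace K]
    [TopologicalSpace Y] [CompactSpace K] [T2Space K] [CompactlyGeneratedSpace B]
    (F : C(K, C(B, Y))) : ∃ G : C(B, C(K, Y)), ∀ b κ, G b κ = F κ b := by
  have hκ : ∀ b, Continuous fun κ => F κ b := fun b => by fun_prop
  refine ⟨⟨fun b => ⟨fun κ => F κ b, hκ b⟩, ?_⟩, fun b κ => rfl⟩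
  refine continuous_from_uCompactlyGeneratedSpace _ fun S g => ?_
  refine ContinuousMap.continuous_of_continuous_uncurry _ ?_
  exact continuous_flip ⟨fun κ => (F κ).comp g,
    (ContinuousMap.continuous_precomp g).comp F.continuous⟩

end CompactlyGenerated

/-! ### The space of self-equivalences -/

section SelfEquivalences

theorem subsingleton_pi_of_extends {X : Type u} [TopologicalSpace X] {k : ℕ}
    (h : ∀ α : C(Cube.boundary (Fin (k + 1)), X), Extends α) (x : X) :
    Subsingleton (HomotopyGroup.Pi k X x) := by
  let f : C(X, Unit) := ContinuousMap.const _ ()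
  have hf : ReflectsExtension (k + 1) f := fun α _ => h α
  have : Subsingleton (HomotopyGroup.Pi k Unit (f x)) := by
    refine ⟨fun a b => ?_⟩
    induction a using Quotient.ind
    induction b using Quotient.ind
    exact congrArg _ (GenLoop.ext _ _ fun y => rfl)
  exact (hf.injective x).subsingleton

/-- Families of self-equivalences parametrised by the boundary of a cube extend over the cube when
`j` lifts against the associated pullback-hom of `u`. -/
theorem extends_hAutRel {P B B' : Type u} [TopologicalSpace P] [TopologicalSpace B]
    [TopologicalSpace B'] [CompactlyGeneratedSpace B] {u : C(B, B')} {j : C(P, B)} {k : ℕ}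
    (hlift : ∀ (a : C(P, C(Fin (k + 1) → I, B)))
      (b : C(B, LiftingProblem (Cube.boundary (Fin (k + 1))) u)),
      (pullbackHom (Cube.boundary (Fin (k + 1))) u).comp a = b.comp j →
        ∃ h : C(B, C(Fin (k + 1) → I, B)), h.comp j = a ∧
          (pullbackHom (Cube.boundary (Fin (k + 1))) u).comp h = b)
    (α : C(Cube.boundary (Fin (k + 1)), hAutRel u j)) : Extends α := by
  have : CompactSpace (Cube.boundary (Fin (k + 1))) :=
    isCompact_iff_compactSpace.1 isClosed_boundary.isCompact
  obtain ⟨A, hA⟩ := exists_flip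
    ((⟨Subtype.val, continuous_subtype_val⟩ : C(hAutRel u j, C(B, B))).comp α)
  have hA' : ∀ b κ, A b κ = (α κ).1 b := hA
  let b : C(B, LiftingProblem (Cube.boundary (Fin (k + 1))) u) :=
    ⟨fun x => ⟨(A x, ContinuousMap.const _ (u x)), fun κ => by
        change u (A x κ) = u x
        rw [hA']; exact DFunLike.congr_fun (α κ).2.2.1 x⟩,
      Continuous.subtype_mk (A.continuous.prodMk
        (ContinuousMap.continuous_const'.comp u.continuous)) _⟩
  let a : C(P, C(Fin (k + 1) → I, B)) :=
    ⟨fun x => ContinuousMap.const _ (j x), ContinuousMap.continuous_const'.comp j.continuous⟩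
  obtain ⟨h, hha, hhb⟩ := hlift a b (by
    ext1 x
    refine Subtype.ext (Prod.ext ?_ rfl)
    ext κ
    change j x = A (j x) κ
    rw [hA']; exact (DFunLike.congr_fun (α κ).2.2.2 x).symm)
  have hev : Continuous fun w : C(Fin (k + 1) → I, B) × (Fin (k + 1) → I) => w.1 w.2 :=
    continuous_eval
  have hc : Continuous fun z : (Fin (k + 1) → I) × B => h z.2 z.1 :=
    hev.comp ((h.continuous.comp continuous_snd).prodMk continuous_fst)
  let Φ : C(Fin (k + 1) → I, C(B, B)) := ContinuousMap.curry ⟨_, hc⟩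
  have hΦ : ∀ κ x, Φ κ x = h x κ := fun κ x => rfl
  have hΦα : ∀ κ : Cube.boundary (Fin (k + 1)), Φ κ.1 = (α κ).1 := by
    intro κ
    ext x
    rw [hΦ, ← hA']
    exact DFunLike.congr_fun (congrArg (fun w => w.1.1) (DFunLike.congr_fun hhb x)) κ
  have hw : ∀ κ, IsWeakEquiv (Φ κ) := by
    intro κ
    have h0 : (0 : Fin (k + 1) → I) ∈ Cube.boundary (Fin (k + 1)) := ⟨0, Or.inl rfl⟩
    have hw0 : IsWeakEquiv (Φ 0) := by rw [hΦα ⟨0, h0⟩]; exact (α ⟨0, h0⟩).2.1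
    refine hw0.of_homotopic ⟨⟨⟨fun z => h z.2 (contract (k + 1) (κ, σ z.1)), ?_⟩, ?_, ?_⟩⟩
    · exact hev.comp (Continuous.prodMk (by fun_prop) (by fun_prop))
    · intro x; simp [hΦ]
    · intro x; simp [hΦ]
  refine ⟨⟨fun κ => ⟨Φ κ, hw κ, ?_, ?_⟩, Φ.continuous.subtype_mk _⟩, fun κ => ?_⟩
  · ext x
    exact DFunLike.congr_fun (congrArg (fun w => w.1.2) (DFunLike.congr_fun hhb x)) κ
  · ext x
    exact DFunLike.congr_fun (DFunLike.congr_fun hha x) κ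
  · exact Subtype.ext (hΦα κ)

/-- A co-connected Serre fibration lifts along the boundary inclusions of large cubes. -/
theorem IsCoconnectedMap.liftsAlong {B : Type u} {B' : Type v} [TopologicalSpace B]
    [TopologicalSpace B'] {n : ℕ} {u : C(B, B')} (hun : IsCoconnectedMap n u)
    (hu : IsSerreFibration u) {d : ℕ} (hd : n ≤ d) :
    LiftsAlong (Cube.boundary (Fin (d + 1))) u := by
  refine hu.liftsAlong_boundary (fun x => ?_)
    fun x => (hun.2.2 (d + 1) (by omega) x).2 (by push_cast; omega)
  rcases Nat.eq_zero_or_pos d with rfl | h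
  · exact piMap_zero_injective_of_pi0Map (hun.1 (by omega)) x
  · exact (hun.2.2 d h x).1 (by exact_mod_cast hd)

theorem IsConnectedMap.comp {X Y Z : Type*} [TopologicalSpace X] [TopologicalSpace Y]
    [TopologicalSpace Z] {m : ℤ} {g : C(Y, Z)} {f : C(X, Y)} (hg : IsConnectedMap m g)
    (hf : IsConnectedMap m f) : IsConnectedMap m (g.comp f) := by
  refine ⟨fun h => ?_, fun h => ?_, fun k hk x => ⟨fun h => ?_, fun h => ?_⟩⟩
  · rw [pi0Map_comp]; exact (hg.1 h).comp (hf.1 h)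
  · rw [pi0Map_comp]; exact (hg.2.1 h).comp (hf.2.1 h)
  · rw [piMap_comp]; exact ((hg.2.2 k hk _).1 h).comp ((hf.2.2 k hk x).1 h)
  · rw [piMap_comp]; exact ((hg.2.2 k hk _).2 h).comp ((hf.2.2 k hk x).2 h)

theorem IsConnectedMap.mono {X Y : Type*} [TopologicalSpace X] [TopologicalSpace Y] {m m' : ℤ}
    {f : C(X, Y)} (hf : IsConnectedMap m f) (h : m' ≤ m) : IsConnectedMap m' f :=
  ⟨fun h' => hf.1 (h'.trans h), fun h' => hf.2.1 (h'.trans_le h), fun k hk x =>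
    ⟨fun h' => (hf.2.2 k hk x).1 (h'.trans h), fun h' => (hf.2.2 k hk x).2 (h'.trans_le h)⟩⟩

theorem isHomotopyType_hAutRel {P B B' : Type u} [TopologicalSpace P] [TopologicalSpace B]
    [TopologicalSpace B'] [CompactlyGeneratedSpace P] {n : ℕ} {c : ℤ} {j : C(P, B)} {u : C(B, B')}
    (hjc : IsConnectedMap c j) (hj : IsCofibration j) (hu : IsSerreFibration u)
    (hun : IsCoconnectedMap n u) : IsHomotopyType (hAutRel u j) ((n : ℤ) - c - 2) := by
  intro k hk φ
  have := hj.compactlyGeneratedSpace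
  refine subsingleton_pi_of_extends (extends_hAutRel fun a b hab => ?_) φ
  refine hj.exists_lift (m := (c + 1).toNat) (fun hm => hjc.1 (by omega))
    (fun k hk hkm x => (hjc.2.2 k hk x).1 (by omega)) (fun k hkm x => ?_) ?_ a b hab
  · rcases Nat.eq_zero_or_pos k with rfl | h
    · exact piMap_zero_injective_of_pi0Map (hjc.2.1 (by omega)) x
    · exact (hjc.2.2 k h x).2 (by omega)
  · refine (hu.pullbackHom (k + 1)).liftsGenerating fun d hd => ?_
    exact LiftsAlong.pullbackHom_boundary (hun.liftsAlong hu (d := d + k) (by omega))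

end SelfEquivalences

end RelHAut

theorem mainTheorem6 {W B B' : Type u} [TopologicalSpace W] [TopologicalSpace B]
    [TopologicalSpace B'] (P : Set W) [CompactlyGeneratedSpace P] (n : ℕ)
    (l : C(W, B)) (u : C(B, B'))
    (hl : RelHAut.IsConnectedMap n l)
    (hlP : RelHAut.IsCofibration (l.comp (RelHAut.incl P)))
    (hu : RelHAut.IsSerreFibration u)
    (hun : RelHAut.IsCoconnectedMap n u) :
    (∀ c : ℤ, c ≤ (n : ℤ) - 1 → RelHAut.IsConnectedPair c P →
      Nonempty (RelHAut.hAutRel u (l.comp (RelHAut.incl P))) ∧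
      RelHAut.IsHomotopyType (RelHAut.hAutRel u (l.comp (RelHAut.incl P))) ((n : ℤ) - c - 2)) ∧
    (RelHAut.IsConnectedPair ((n : ℤ) - 1) P →
      RelHAut.IsWeaklyContractible (RelHAut.hAutRel u (l.comp (RelHAut.incl P)))) := by
  have key : ∀ c : ℤ, c ≤ (n : ℤ) - 1 → RelHAut.IsConnectedPair c P →
      Nonempty (RelHAut.hAutRel u (l.comp (RelHAut.incl P))) ∧
      RelHAut.IsHomotopyType (RelHAut.hAutRel u (l.comp (RelHAut.incl P)))
        ((n : ℤ) - c - 2) := fun c hc hP =>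
    ⟨⟨1⟩, RelHAut.isHomotopyType_hAutRel ((hl.mono (by omega)).comp hP) hlP hu hun⟩
  refine ⟨key, fun hP => ?_⟩
  obtain ⟨h₁, h₂⟩ := key _ le_rfl hP
  exact ⟨h₁, fun k x => h₂ k (by omega) x⟩
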